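/- Let $N\ge 2$, $b\ge 2$, $r\ge 1$ be integers, let $\alpha\in(0,1)$, $\varepsilon>0$, and let $\mu_1\ge\mu_2\ge\dots\ge\mu_N\ge\varepsilon$ be real numbers with $\sum_{n=1}^N\mu_n=N$. Consider $N$ parallel servers. Jobs arrive according to a Poisson process of rate $\lambda N$ with $\lambda=1-N^{-\alpha}$, server $n$ has exponential service times with service rate $\mu_n$, and each server holds at most $b$ jobs (one in service and $b-1$ in its buffer). Under the Join-the-Fastest-Shortest-Queue (JFSQ) policy an arriving job is routed to a server with the shortest queue, among these to one with the largest service rate, remaining ties being broken uniformly at random; the job is discarded if that server already holds $b$ jobs. Let $Q=(Q_1,\dots,Q_N)$ be distributed according to the steady-state (stationary) distribution of the resulting continuous-time Markov chain on $\{0,\dots,b\}^N$ of queue lengths (jobs in service included), and let $\bar Q=\frac1N\sum_{n=1}^N Q_n$. Here $\log$ is the natural logarithm. 1) (Sub-Halfin–Whitt regime.) Suppose $\alpha\in(0,\tfrac12)$, $$\max\left\{\frac{2(r+1)}{\log N},\ \frac{27(r+1)\,b\log N}{N^{0.25-0.5\alpha}}\right\}\le\varepsilon\le 0.5,\qquad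 \frac{\mu_1}{\varepsilon^2}\le\frac{N^{1-\alpha}}{64\,b\,(2\log^2N+3)},$$ and that there is an index $N_2\in\{1,\dots,N\}$ with $\sum_{n=1}^{N_2}\mu_n=\lambda N$. Put $k_{sub}=\frac{16(b-1)\mu_{N_2}}{\varepsilon^2}$. Then $$\mathbb E\left[\left(\max\left\{\bar Q-\frac{N_2}{N}-\left(1-\frac{4}{k_{sub}\,\varepsilon}\right)\frac1{N^{\alpha}},\,0\right\}\right)^r\right]\le\left(\frac{k_{sub}}{N^{1-\alpha}}\right)^r .$$ 2) (Super-Halfin–Whitt regime.) Suppose $\alpha\in[\tfrac12,1)$ and $$\frac{\mu_1}{\varepsilon}\le\frac{N^{1-\alpha}}{24\,r\,b\log^2N}.$$ Put $k_{super}=\frac{24\,r\,(b-1)\mu_1}{\varepsilon}$. Then $$\mathbb E\left[\left(\max\left\{\bar Q-1-\frac{k_{super}\log N}{N^{1-\alpha}},\,0\right\}\right)^r\right]\le 10\left(\frac{2r}{N^{1-\alpha}}\right)^r .$$ -/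

import Mathlib

open Finset

namespace JFSQ

/-- Queue-length vectors of `N` servers: every server holds at most `b` jobs, one in service and
`b - 1` in its buffer. -/
abbrev State (N b : ℕ) : Type := Fin N → Fin (b + 1)

/-- The servers to which Join-the-Fastest-Shortest-Queue may send a job that finds the queue lengths
`q`: those of largest service rate among the servers with the shortest queue. -/
noncomputable def fastestShortest {N b : ℕ} (μ : Fin N → ℝ) (q : State N b) : Finset (Fin N) :=
  open Classical in
  univ.filter fun n => (∀ m, q n ≤ q m) ∧ ∀ m, (∀ l, q m ≤ q l) → μ m ≤ μ n

/-- The probability that a job arriving in state `q` is routed to server `n` (ties in both queue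
length and service rate are broken uniformly at random). -/
noncomputable def routeProb {N b : ℕ} (μ : Fin N → ℝ) (q : State N b) (n : Fin N) : ℝ :=
  open Classical in
  if n ∈ fastestShortest μ q then 1 / ((fastestShortest μ q).card : ℝ) else 0

/-- The state after a job has been routed to server `n`; the job is discarded if the server already
holds `b` jobs. -/
def arrive {N b : ℕ} (q : State N b) (n : Fin N) : State N b :=
  Function.update q n ⟨min ((q n : ℕ) + 1) b, by omega⟩

/-- The state after a service completion at server `n` (nothing happens at an idle server). -/
def depart {N b : ℕ} (q : State N b) (n : Fin N) : State N b :=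
  Function.update q n ⟨(q n : ℕ) - 1, by omega⟩

/-- The rate of jumps from `q` to a different state `q'` when jobs arrive as a Poisson process of
rate `Λ` and service at server `n` is exponential with rate `μ n`. -/
noncomputable def rate {N b : ℕ} (Λ : ℝ) (μ : Fin N → ℝ) (q q' : State N b) : ℝ :=
  (∑ n, if arrive q n = q' then Λ * routeProb μ q n else 0) +
    ∑ n, if depart q n = q' then μ n else 0

/-- The generator (Q-matrix) of the queue-length Markov chain under JFSQ. -/
noncomputable def generator {N b : ℕ} (Λ : ℝ) (μ : Fin N → ℝ) :
    Matrix (State N b) (State N b) ℝ :=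
  Matrix.of fun q q' =>
    if q = q' then -∑ z ∈ univ.erase q, rate Λ μ q z else rate Λ μ q q'

/-- The transition matrix of the queue-length Markov chain over a time span `t`. -/
noncomputable def transition {N b : ℕ} (Λ : ℝ) (μ : Fin N → ℝ) (t : ℝ) :
    Matrix (State N b) (State N b) ℝ :=
  NormedSpace.exp (t • generator Λ μ)

/-- `π` is a steady-state (stationary) distribution of the queue-length Markov chain: a probability
vector that is preserved by the transition matrices at all times. -/
def IsSteadyState {N b : ℕ} (Λ : ℝ) (μ : Fin N → ℝ) (π : State N b → ℝ) : Prop :=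
  π ∈ stdSimplex ℝ (State N b) ∧ ∀ t : ℝ, 0 ≤ t → Matrix.vecMul π (transition Λ μ t) = π

/-- Expectation of `f(Q)` when `Q` has distribution `π`. -/
def expect {N b : ℕ} (π : State N b → ℝ) (f : State N b → ℝ) : ℝ := ∑ q, π q * f q

/-- The average queue length. -/
noncomputable def avgQueue {N b : ℕ} (q : State N b) : ℝ := (1 / (N : ℝ)) * ∑ n, ((q n : ℕ) : ℝ)

/-- The normalized load `λ = 1 - N ^ (-α)`. -/
noncomputable def load (N : ℕ) (α : ℝ) : ℝ := 1 - (N : ℝ) ^ (-α)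

/-- The condition on the parameters in the Sub-Halfin-Whitt regime (`μ₁` is the largest rate). -/
def SubCondition (N b r : ℕ) (α ε μ₁ : ℝ) : Prop :=
  max (2 * ((r : ℝ) + 1) / Real.log N)
      (27 * ((r : ℝ) + 1) * b * Real.log N / (N : ℝ) ^ (0.25 - 0.5 * α)) ≤ ε ∧
    ε ≤ 0.5 ∧
    μ₁ / ε ^ 2 ≤ (N : ℝ) ^ (1 - α) / (64 * b * (2 * Real.log N ^ 2 + 3))

/-- The condition on the parameters in the Super-Halfin-Whitt regime (`μ₁` is the largest rate). -/
def SuperCondition (N b r : ℕ) (α ε μ₁ : ℝ) : Prop :=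
  μ₁ / ε ≤ (N : ℝ) ^ (1 - α) / (24 * r * b * Real.log N ^ 2)

/-- `k_sub`, where `μN₂` is the rate of the slowest of the `N₂` fastest servers. -/
noncomputable def kSub (b : ℕ) (ε μN₂ : ℝ) : ℝ := 16 * ((b : ℝ) - 1) * μN₂ / ε ^ 2

/-- `k_super`, where `μ₁` is the largest rate. -/
noncomputable def kSuper (b r : ℕ) (ε μ₁ : ℝ) : ℝ := 24 * r * ((b : ℝ) - 1) * μ₁ / ε

end JFSQ

/-! Write `x = N ^ (1 - α)` for the spare capacity, so that jobs arrive at rate `N - x`. In the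
steady state every function has mean drift zero. Hence a function with bounded jumps and drift at
most `-γ` above some level has a geometric tail there, up to an error proportional to the
probability of the states where the drift bound fails (`prob_step`, `prob_tail_int`,
`prob_tail_real`). Both parts apply this twice: once to show that the servers rarely work too
slowly, once to bound the number of jobs.

Super-Halfin–Whitt (`x ^ 2 ≤ N`). An arrival that finds an idle server goes to one. Many waiting
jobs mean many servers with at least two jobs, whose completions create no idle server. So the
minimum of the number of idle servers and the excess of waiting jobs over `A₀` has negative drift
(`prob_idle_and_waiting_le`). With more than `N + A₀` jobs that minimum is the number of idle
servers, so the service rate is at least `N - x / 2` with high probability. Then the number of jobs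
has drift at most `-x / 2`, and its geometric tail, with scale of order `N / x`, is summed to a
moment bound.

Sub-Halfin–Whitt. Now it matters that idle servers are filled fastest first. For each `i` below
`N₂`, the number of busy servers among those at least as fast as `i` reverts to `i + 1`, so its
deficit is rarely more than of order `√(N log N / μ i)` (`prob_deficit_le`). Summation by parts over
the levels of the rates turns these deficits into a bound on the lost service rate
(`le_serviceRate`). It is small against `ε x`, so once `N₂ + x / 2` servers are busy the service
rate exceeds the arrival rate by at least `ε x / 8`. A Lyapunov function made of the waiting jobs
and a smoothed excess of busy servers then has negative drift, and more than `N₂ + 3 x / 4` jobs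
have probability at most `2 / N ^ r`. As the average queue is at most `b`, this already gives the
moment bound. -/

namespace JFSQ

variable {N b : ℕ}

/-! ### The generator and stationarity -/

/-- The generator applied to a test function, written as a sum over arrivals and departures. -/
noncomputable def gen (Λ : ℝ) (μ : Fin N → ℝ) (f : State N b → ℝ) (q : State N b) : ℝ :=
  Λ * ∑ n, routeProb μ q n * (f (arrive q n) - f q) + ∑ n, μ n * (f (depart q n) - f q)

theorem sum_rate_mul (Λ : ℝ) (μ : Fin N → ℝ) (f : State N b → ℝ) (q : State N b) :
    ∑ q', rate Λ μ q q' * (f q' - f q) = gen Λ μ f q := by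
  simp only [rate, gen, add_mul, sum_add_distrib, sum_mul, mul_sum]
  congr 1
  · rw [sum_comm]
    refine sum_congr rfl fun n _ => ?_
    simp [ite_mul, mul_assoc]
  · rw [sum_comm]
    refine sum_congr rfl fun n _ => ?_
    simp [ite_mul]

theorem generator_mulVec (Λ : ℝ) (μ : Fin N → ℝ) (f : State N b → ℝ) (q : State N b) :
    (generator Λ μ).mulVec f q = gen Λ μ f q := by
  rw [← sum_rate_mul, Matrix.mulVec, dotProduct, ← add_sum_erase _ _ (mem_univ q),
    ← add_sum_erase (a := q) univ (fun q' => rate Λ μ q q' * (f q' - f q)) (mem_univ q)]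
  have h : ∀ q' ∈ univ.erase q, generator Λ μ q q' * f q' = rate Λ μ q q' * f q' := by
    intro q' hq'
    simp [generator, (ne_of_mem_erase hq').symm]
  rw [sum_congr rfl h]
  simp only [generator, Matrix.of_apply, if_true, mul_sub, sum_sub_distrib, ← sum_mul]
  ring

-- Differentiate the invariance under the transition matrices at time `0`. The matrix norm serves
-- only to differentiate the exponential.
attribute [local instance] Matrix.linftyOpNormedRing Matrix.linftyOpNormedAlgebra in
theorem vecMul_generator_eq_zero {Λ : ℝ} {μ : Fin N → ℝ} {π : State N b → ℝ}
    (hπ : IsSteadyState Λ μ π) : Matrix.vecMul π (generator Λ μ) = 0 := by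
  have hd : HasDerivAt (fun t : ℝ => NormedSpace.exp (t • generator (b := b) Λ μ))
      (generator Λ μ) 0 := by
    have := hasDerivAt_exp_smul_const (𝕂 := ℝ) (generator (b := b) Λ μ) (0 : ℝ)
    rw [zero_smul, NormedSpace.exp_zero, one_mul] at this
    exact this
  ext q
  let L : Matrix (State N b) (State N b) ℝ →ₗ[ℝ] ℝ :=
    { toFun := fun M => Matrix.vecMul π M q
      map_add' := fun A B => by simp [Matrix.vecMul_add]
      map_smul' := fun c A => by simp [Matrix.vecMul_smul] }
  have hL : HasDerivAt (fun t : ℝ => L (transition Λ μ t)) (L (generator Λ μ)) 0 :=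
    (LinearMap.toContinuousLinearMap L).hasFDerivAt.comp_hasDerivAt (0 : ℝ) hd
  -- Invariance is known only for `0 ≤ t`, so the derivatives are compared on the right of `0`.
  have hc : HasDerivWithinAt (fun t : ℝ => L (transition Λ μ t)) 0 (Set.Ici 0) 0 := by
    refine (hasDerivWithinAt_const (0 : ℝ) (Set.Ici 0) (π q)).congr_of_mem ?_ (by simp)
    intro t ht
    exact congrFun (hπ.2 t ht) q
  exact (uniqueDiffWithinAt_Ici (0 : ℝ)).eq_deriv _ hL.hasDerivWithinAt hc

theorem sum_mul_gen_eq_zero {Λ : ℝ} {μ : Fin N → ℝ} {π : State N b → ℝ}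
    (hπ : IsSteadyState Λ μ π) (f : State N b → ℝ) : ∑ q, π q * gen Λ μ f q = 0 := by
  have h : π ⬝ᵥ (generator Λ μ).mulVec f = 0 := by
    rw [Matrix.dotProduct_mulVec, vecMul_generator_eq_zero hπ, zero_dotProduct]
  simpa [dotProduct, generator_mulVec] using h

/-! ### Routing -/

theorem fastestShortest_nonempty (hN : 0 < N) (μ : Fin N → ℝ) (q : State N b) :
    (fastestShortest μ q).Nonempty := by
  classical
  have : Nonempty (Fin N) := ⟨⟨0, hN⟩⟩
  obtain ⟨n₀, -, h₀⟩ := exists_min_image univ q univ_nonempty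
  obtain ⟨n, hn, h⟩ := exists_max_image (univ.filter fun n => ∀ m, q n ≤ q m) μ
    ⟨n₀, by simpa using h₀⟩
  refine ⟨n, ?_⟩
  simp only [fastestShortest, mem_filter, mem_univ, true_and] at hn h ⊢
  exact ⟨hn, h⟩

theorem routeProb_nonneg (μ : Fin N → ℝ) (q : State N b) (n : Fin N) : 0 ≤ routeProb μ q n := by
  unfold routeProb
  split_ifs <;> positivity

theorem routeProb_eq_zero {μ : Fin N → ℝ} {q : State N b} {n : Fin N}
    (h : n ∉ fastestShortest μ q) : routeProb μ q n = 0 := if_neg h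

theorem sum_routeProb (hN : 0 < N) (μ : Fin N → ℝ) (q : State N b) :
    ∑ n, routeProb μ q n = 1 := by
  classical
  have h := fastestShortest_nonempty hN μ q
  have h' : ((fastestShortest μ q).card : ℝ) ≠ 0 := by
    exact_mod_cast h.card_pos.ne'
  unfold routeProb
  rw [sum_ite_mem, univ_inter, sum_const, nsmul_eq_mul]
  field_simp

/-- Only the upward effect of a jump has to be bounded, and for arrivals only at servers that the
policy may choose. -/
theorem gen_le {Λ : ℝ} {μ : Fin N → ℝ} {f : State N b → ℝ} {q : State N b} (hN : 0 < N)
    (hΛ : 0 ≤ Λ) (hμ : ∀ n, 0 ≤ μ n) {a : ℝ} {d : Fin N → ℝ}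
    (ha : ∀ n ∈ fastestShortest μ q, f (arrive q n) ≤ f q + a)
    (hd : ∀ n, f (depart q n) ≤ f q + d n) :
    gen Λ μ f q ≤ Λ * a + ∑ n, μ n * d n := by
  unfold gen
  refine add_le_add (mul_le_mul_of_nonneg_left ?_ hΛ)
    (sum_le_sum fun n _ => mul_le_mul_of_nonneg_left (by linarith [hd n]) (hμ n))
  calc ∑ n, routeProb μ q n * (f (arrive q n) - f q) ≤ ∑ n, routeProb μ q n * a := by
        refine sum_le_sum fun n _ => ?_
        by_cases h : n ∈ fastestShortest μ q
        · exact mul_le_mul_of_nonneg_left (by linarith [ha n h]) (routeProb_nonneg _ _ _)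
        · simp [routeProb_eq_zero h]
    _ = a := by rw [← sum_mul, sum_routeProb hN, one_mul]

/-- An arriving job that finds an idle server is routed to a fastest idle server. -/
theorem idle_of_mem_fastestShortest {μ : Fin N → ℝ} {q : State N b} {m n : Fin N}
    (hm : (q m : ℕ) = 0) (hn : n ∈ fastestShortest μ q) : (q n : ℕ) = 0 ∧ μ m ≤ μ n := by
  simp only [fastestShortest, mem_filter, mem_univ, true_and] at hn
  have h1 : (q n : ℕ) ≤ q m := hn.1 m
  exact ⟨by omega, hn.2 m fun l => by rw [Fin.le_def]; omega⟩

/-! ### Busy servers, waiting jobs and service rates -/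

/-- The number of busy servers in `G`. -/
def busy (G : Finset (Fin N)) (q : State N b) : ℤ := ∑ n ∈ G, if (q n : ℕ) = 0 then 0 else 1

/-- The number of waiting jobs. -/
def waiting (q : State N b) : ℤ := ∑ n, (((q n : ℕ) - 1 : ℕ) : ℤ)

/-- The number of jobs in the system. -/
def total (q : State N b) : ℤ := ∑ n, ((q n : ℕ) : ℤ)

theorem sum_update (G : Finset (Fin N)) (g : ℕ → ℤ) (q : State N b) (n : Fin N)
    (v : Fin (b + 1)) :
    ∑ m ∈ G, g (Function.update q n v m) =
      ∑ m ∈ G, g (q m) + if n ∈ G then g v - g (q n) else 0 := by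
  rw [← sub_eq_iff_eq_add', ← sum_sub_distrib]
  rw [sum_congr rfl (g := fun m => if m = n then g v - g (q n) else 0)]
  · simp
  · intro m _
    by_cases h : m = n
    · subst h; simp
    · simp [h]

theorem busy_arrive (hb : 0 < b) (G : Finset (Fin N)) (q : State N b) (n : Fin N) :
    busy G (arrive q n) = busy G q + if n ∈ G ∧ (q n : ℕ) = 0 then 1 else 0 := by
  unfold busy arrive
  rw [sum_update G (fun k => if k = 0 then 0 else 1)]
  have : min ((q n : ℕ) + 1) b ≠ 0 := by omega
  by_cases h : n ∈ G <;> by_cases h' : (q n : ℕ) = 0 <;> simp [h, h'] <;> omega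

theorem busy_depart (G : Finset (Fin N)) (q : State N b) (n : Fin N) :
    busy G (depart q n) = busy G q - if n ∈ G ∧ (q n : ℕ) = 1 then 1 else 0 := by
  unfold busy depart
  rw [sum_update G (fun k => if k = 0 then 0 else 1)]
  by_cases h : n ∈ G <;> by_cases h' : (q n : ℕ) = 0 <;> by_cases h'' : (q n : ℕ) = 1 <;>
    simp [h, h', h'']
  · omega
  · rw [if_neg (by omega)]
    norm_num

theorem waiting_arrive (hb : 0 < b) (q : State N b) (n : Fin N) :
    waiting (arrive q n) = waiting q + if 1 ≤ (q n : ℕ) ∧ (q n : ℕ) < b then 1 else 0 := by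
  unfold waiting arrive
  rw [sum_update univ (fun k => ((k - 1 : ℕ) : ℤ))]
  have := (q n).2
  simp only [mem_univ, if_true]
  split_ifs <;> omega

theorem waiting_depart (q : State N b) (n : Fin N) :
    waiting (depart q n) = waiting q - if 2 ≤ (q n : ℕ) then 1 else 0 := by
  unfold waiting depart
  rw [sum_update univ (fun k => ((k - 1 : ℕ) : ℤ))]
  simp only [mem_univ, if_true]
  split_ifs <;> omega

theorem total_eq (q : State N b) : total q = busy univ q + waiting q := by
  unfold total busy waiting
  rw [← sum_add_distrib]
  refine sum_congr rfl fun n _ => ?_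
  split_ifs <;> omega

theorem busy_nonneg (G : Finset (Fin N)) (q : State N b) : 0 ≤ busy G q :=
  sum_nonneg fun _ _ => by split_ifs <;> simp

theorem busy_le_card (G : Finset (Fin N)) (q : State N b) : busy G q ≤ G.card := by
  rw [busy, ← mul_one (G.card : ℤ), ← nsmul_eq_mul, ← sum_const]
  exact sum_le_sum fun _ _ => by split_ifs <;> simp

theorem exists_idle {G : Finset (Fin N)} {q : State N b} (h : busy G q < G.card) :
    ∃ n ∈ G, (q n : ℕ) = 0 := by
  by_contra! hc
  have : busy G q = G.card := by
    rw [busy, sum_congr rfl fun n hn => if_neg (hc n hn)]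
    simp
  omega

theorem total_le (q : State N b) : total q ≤ b * N := by
  calc total q ≤ ∑ _n : Fin N, (b : ℤ) := sum_le_sum fun n _ => by have := (q n).2; omega
    _ = b * N := by simp [mul_comm]

/-- The total service rate of the servers whose queue length satisfies `p`. -/
noncomputable def serviceRate (μ : Fin N → ℝ) (p : ℕ → Prop) [DecidablePred p]
    (q : State N b) : ℝ :=
  ∑ n, μ n * if p (q n) then 1 else 0

theorem serviceRate_add (μ : Fin N → ℝ) (q : State N b) :
    serviceRate μ (· = 1) q + serviceRate μ (2 ≤ ·) q = serviceRate μ (1 ≤ ·) q := by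
  unfold serviceRate
  rw [← sum_add_distrib]
  refine sum_congr rfl fun n _ => ?_
  rw [← mul_add]
  congr 1
  split_ifs <;> first | omega | norm_num

/-- A server with a waiting job has at most `b - 1` of them and works at rate at least `ε`. -/
theorem mul_waiting_le {μ : Fin N → ℝ} {ε : ℝ} (hε : 0 ≤ ε) (hμ : ∀ n, ε ≤ μ n) (q : State N b) :
    ε * waiting q ≤ ((b : ℝ) - 1) * serviceRate μ (2 ≤ ·) q := by
  unfold serviceRate waiting
  push_cast
  rw [mul_sum, mul_sum]
  refine sum_le_sum fun n _ => ?_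
  have h2 := (q n).2
  by_cases h : 2 ≤ (q n : ℕ)
  · have : (((q n : ℕ) - 1 : ℕ) : ℝ) ≤ (b : ℝ) - 1 := by
      rw [Nat.cast_sub (by omega)]
      have : ((q n : ℕ) : ℝ) ≤ b := by exact_mod_cast (by omega)
      simp only [Nat.cast_one]
      linarith
    rw [if_pos h, mul_one, mul_comm]
    exact mul_le_mul this (hμ n) hε (le_trans (by positivity) this)
  · have : (q n : ℕ) - 1 = 0 := by omega
    simp [h, this]

/-! ### Drift and geometric tails -/

/-- The probability of the event `p` when the state has distribution `π`. -/
noncomputable def prob (π : State N b → ℝ) (p : State N b → Prop) : ℝ :=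
  open Classical in ∑ q, if p q then π q else 0

section Prob

variable {π : State N b → ℝ}

theorem prob_nonneg (hπ : π ∈ stdSimplex ℝ (State N b)) (p : State N b → Prop) : 0 ≤ prob π p :=
  sum_nonneg fun q _ => by split_ifs; exacts [hπ.1 q, le_rfl]

theorem prob_mono (hπ : π ∈ stdSimplex ℝ (State N b)) {p p' : State N b → Prop}
    (h : ∀ q, p q → p' q) : prob π p ≤ prob π p' := by
  refine sum_le_sum fun q _ => ?_
  by_cases h1 : p q
  · simp [h1, h q h1]
  · simp only [h1, if_false]
    split_ifs; exacts [hπ.1 q, le_rfl]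

theorem prob_le_one (hπ : π ∈ stdSimplex ℝ (State N b)) (p : State N b → Prop) :
    prob π p ≤ 1 := by
  rw [← hπ.2]
  exact sum_le_sum fun q _ => by split_ifs; exacts [le_rfl, hπ.1 q]

theorem prob_exists_le {ι : Type*} (hπ : π ∈ stdSimplex ℝ (State N b)) (s : Finset ι)
    (p : ι → State N b → Prop) : prob π (fun q => ∃ i ∈ s, p i q) ≤ ∑ i ∈ s, prob π (p i) := by
  classical
  unfold prob
  rw [sum_comm]
  refine sum_le_sum fun q _ => ?_
  have h0 : ∀ i ∈ s, 0 ≤ if p i q then π q else 0 := fun i _ => by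
    split_ifs; exacts [hπ.1 q, le_rfl]
  split_ifs with h
  · obtain ⟨i, hi, hp⟩ := h
    calc π q = if p i q then π q else 0 := by simp [hp]
      _ ≤ _ := single_le_sum h0 hi
  · exact sum_nonneg h0

/-- One step of a drift argument: `u < V` is less likely than `l < V` by a constant factor, up to
the probability of an exceptional event. -/
theorem prob_step {Λ : ℝ} {μ : Fin N → ℝ} (hπ : IsSteadyState Λ μ π) (f V : State N b → ℝ)
    {l u U γ : ℝ} (bad : State N b → Prop) (hlu : l ≤ u) (hγ : 0 ≤ γ)
    (h0 : ∀ q, V q ≤ l → gen Λ μ f q ≤ 0) (h1 : ∀ q, l < V q → gen Λ μ f q ≤ U)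
    (h2 : ∀ q, u < V q → ¬ bad q → gen Λ μ f q ≤ -γ) (hU : 0 ≤ U) :
    (U + γ) * prob π (fun q => u < V q) ≤
      U * prob π (fun q => l < V q) + (U + γ) * prob π bad := by
  classical
  -- A pointwise bound of the drift by indicators; summed over `q` its left side vanishes by
  -- stationarity.
  have key : ∀ q, π q * gen Λ μ f q ≤ U * (if l < V q then π q else 0)
      + (U + γ) * (if bad q then π q else 0) - (U + γ) * (if u < V q then π q else 0) := by
    intro q
    have hq := hπ.1.1 q
    have e : U * (if l < V q then π q else 0)
      + (U + γ) * (if bad q then π q else 0) - (U + γ) * (if u < V q then π q else 0)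
      = π q * (U * (if l < V q then 1 else 0) + (U + γ) * (if bad q then 1 else 0)
        - (U + γ) * (if u < V q then 1 else 0)) := by
      split_ifs <;> ring
    rw [e]
    refine mul_le_mul_of_nonneg_left ?_ hq
    by_cases hl : l < V q
    · by_cases hu : u < V q
      · by_cases hbad : bad q
        · simp only [hl, hu, hbad, if_true]
          linarith [h1 q hl]
        · simp only [hl, hu, hbad, if_true, if_false]
          linarith [h2 q hu hbad]
      · simp only [hl, hu, if_true, if_false]
        have : 0 ≤ (U + γ) * (if bad q then 1 else 0) := by split_ifs <;> simp; linarith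
        linarith [h1 q hl]
    · have hu : ¬ u < V q := by linarith
      simp only [hl, hu, if_false]
      have : 0 ≤ (U + γ) * (if bad q then 1 else 0) := by split_ifs <;> simp; linarith
      linarith [h0 q (by linarith)]
  have hs := sum_le_sum fun q (_ : q ∈ univ) => key q
  rw [sum_mul_gen_eq_zero hπ, sum_sub_distrib, sum_add_distrib, ← mul_sum, ← mul_sum,
    ← mul_sum] at hs
  unfold prob
  linarith

end Prob

/-- The recursion contracts by `U / (U + γ) ≤ exp (-(γ / (U + γ)))` and has fixed point `β * ((U +
γ) / γ)`. -/
theorem geom_iterate {T : ℕ → ℝ} {U γ β : ℝ} (hU : 0 ≤ U) (hγ : 0 < γ) (hβ : 0 ≤ β)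
    (h0 : T 0 ≤ 1) (hT : ∀ n, (U + γ) * T (n + 1) ≤ U * T n + (U + γ) * β) (n : ℕ) :
    T n ≤ Real.exp (-(n * (γ / (U + γ)))) + β * ((U + γ) / γ) := by
  have hp : 0 < U + γ := by linarith
  have h1 : ∀ n, T n ≤ (U / (U + γ)) ^ n + β * ((U + γ) / γ) := by
    intro n
    induction n with
    | zero =>
      have : 0 ≤ β * ((U + γ) / γ) := by positivity
      simpa using by linarith
    | succ n ih =>
      have h2 := hT n
      have h3 : T (n + 1) ≤ U / (U + γ) * T n + β := by
        rw [div_mul_eq_mul_div, ← sub_le_iff_le_add, le_div_iff₀ hp]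
        linarith
      have h4 := mul_le_mul_of_nonneg_left ih (by positivity : 0 ≤ U / (U + γ))
      have h5 : U / (U + γ) * (β * ((U + γ) / γ)) + β = β * ((U + γ) / γ) := by
        field_simp
      rw [pow_succ]
      linarith
  refine (h1 n).trans (add_le_add_left ?_ _)
  have h6 : U / (U + γ) ≤ Real.exp (-(γ / (U + γ))) := by
    have := Real.add_one_le_exp (-(γ / (U + γ)))
    have h7 : U / (U + γ) = -(γ / (U + γ)) + 1 := by field_simp; ring
    linarith
  calc (U / (U + γ)) ^ n ≤ Real.exp (-(γ / (U + γ))) ^ n :=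
        pow_le_pow_left₀ (by positivity) h6 n
    _ = _ := by rw [← Real.exp_nat_mul]; congr 1; ring

variable {Λ : ℝ} {μ : Fin N → ℝ} {π : State N b → ℝ}

theorem gen_congr {f g : State N b → ℝ} {q : State N b} (c : ℝ) (h : f q = g q - c)
    (ha : ∀ n ∈ fastestShortest μ q, f (arrive q n) = g (arrive q n) - c)
    (hd : ∀ n, f (depart q n) = g (depart q n) - c) : gen Λ μ f q = gen Λ μ g q := by
  unfold gen
  congr 1
  · congr 1
    refine sum_congr rfl fun n _ => ?_
    by_cases hn : n ∈ fastestShortest μ q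
    · rw [ha n hn, h]; ring
    · simp [routeProb_eq_zero hn]
  · refine sum_congr rfl fun n _ => ?_
    rw [hd n, h]; ring

/-- The test function is `max (V - c) 0`. No jump from below `l` makes it positive, and above `u`
the truncation is not felt, so there its drift is that of `V`. -/
theorem prob_step_of_drift (hN : 0 < N) (hΛ : 0 ≤ Λ) (hμ : ∀ n, 0 ≤ μ n)
    (hπ : IsSteadyState Λ μ π) (V : State N b → ℝ) (bad : State N b → Prop)
    {c l u U γ a d : ℝ} (hlc : l ≤ c) (hcu : c ≤ u) (ha : 0 ≤ a) (hd : 0 ≤ d)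
    (hU : Λ * a + ∑ n, μ n * d ≤ U) (hγ : 0 ≤ γ)
    (hla : ∀ q, V q ≤ l → ∀ n ∈ fastestShortest μ q, V (arrive q n) ≤ c)
    (hld : ∀ q, V q ≤ l → ∀ n, V (depart q n) ≤ c)
    (hua : ∀ q, u < V q → ∀ n ∈ fastestShortest μ q, c ≤ V (arrive q n))
    (hud : ∀ q, u < V q → ∀ n, c ≤ V (depart q n))
    (hja : ∀ q, l < V q → ∀ n ∈ fastestShortest μ q, V (arrive q n) ≤ V q + a)
    (hjd : ∀ q, l < V q → ∀ n, V (depart q n) ≤ V q + d)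
    (hdrift : ∀ q, u < V q → ¬ bad q → gen Λ μ V q ≤ -γ) :
    (U + γ) * prob π (fun q => u < V q) ≤
      U * prob π (fun q => l < V q) + (U + γ) * prob π bad := by
  have hU0 : 0 ≤ U := by
    have : 0 ≤ ∑ n, μ n * d := sum_nonneg fun n _ => mul_nonneg (hμ n) hd
    have : 0 ≤ Λ * a := mul_nonneg hΛ ha
    linarith
  refine prob_step hπ (fun q => max (V q - c) 0) V bad (hlc.trans hcu) hγ ?_ ?_ ?_ hU0
  · intro q hq
    have := gen_le (f := fun q => max (V q - c) 0) (q := q) hN hΛ hμ (a := 0) (d := fun _ => 0)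
      (fun n hn => by
        simp only [add_zero]
        exact max_le (by linarith [hla q hq n hn, le_max_right (V q - c) 0]) (le_max_right _ _))
      (fun n => by
        simp only [add_zero]
        exact max_le (by linarith [hld q hq n, le_max_right (V q - c) 0]) (le_max_right _ _))
    simpa using this
  · intro q hq
    refine (gen_le (f := fun q => max (V q - c) 0) (q := q) hN hΛ hμ (a := a) (d := fun _ => d)
      (fun n hn => ?_) (fun n => ?_)).trans hU
    · exact max_le (by linarith [hja q hq n hn, le_max_left (V q - c) 0])
        (by linarith [le_max_right (V q - c) 0])
    · exact max_le (by linarith [hjd q hq n, le_max_left (V q - c) 0])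
        (by linarith [le_max_right (V q - c) 0])
  · intro q hq hb
    rw [gen_congr (g := V) c (max_eq_left (by linarith))
      (fun n hn => max_eq_left (by linarith [hua q hq n hn]))
      (fun n => max_eq_left (by linarith [hud q hq n]))]
    exact hdrift q hq hb

/-- Exponential tail of an integer-valued function of the steady state that has negative drift. -/
theorem prob_tail_int (hN : 0 < N) (hΛ : 0 ≤ Λ) (hμ : ∀ n, 0 ≤ μ n)
    (hπ : IsSteadyState Λ μ π) (V : State N b → ℤ) (bad : State N b → Prop) (c₀ : ℤ)
    {U γ : ℝ} {a d : ℤ} (ha : 0 ≤ a) (hd : 0 ≤ d)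
    (hU : Λ * a + ∑ n, μ n * d ≤ U) (hγ : 0 < γ)
    (hja : ∀ q n, n ∈ fastestShortest μ q → V q - 1 ≤ V (arrive q n) ∧ V (arrive q n) ≤ V q + 1)
    (hjd : ∀ q n, V q - 1 ≤ V (depart q n) ∧ V (depart q n) ≤ V q + 1)
    (hja' : ∀ q n, c₀ ≤ V q → n ∈ fastestShortest μ q → V (arrive q n) ≤ V q + a)
    (hjd' : ∀ q n, c₀ ≤ V q → V (depart q n) ≤ V q + d)
    (hdrift : ∀ q, c₀ < V q → ¬ bad q → gen Λ μ (fun q => (V q : ℝ)) q ≤ -γ) (n : ℕ) :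
    prob π (fun q => c₀ + n ≤ V q) ≤
      Real.exp (-(n * (γ / (U + γ)))) + prob π bad * ((U + γ) / γ) := by
  have hU0 : 0 ≤ U := by
    have : 0 ≤ ∑ n, μ n * d := sum_nonneg fun n _ => mul_nonneg (hμ n) (by exact_mod_cast hd)
    have : 0 ≤ Λ * a := mul_nonneg hΛ (by exact_mod_cast ha)
    linarith
  refine geom_iterate (T := fun n : ℕ => prob π (fun q => c₀ + n ≤ V q)) hU0 hγ
    (prob_nonneg hπ.1 _) (prob_le_one hπ.1 _) (fun n => ?_) n
  -- For integer values and unit jumps the level `c = u = l + 1` separates the two regions.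
  have := prob_step_of_drift hN hΛ hμ hπ (fun q => (V q : ℝ)) bad (c := ((c₀ + n : ℤ) : ℝ))
    (l := ((c₀ + n - 1 : ℤ) : ℝ)) (u := ((c₀ + n : ℤ) : ℝ)) (U := U) (γ := γ) (a := (a : ℝ))
    (d := (d : ℝ)) (by exact_mod_cast (by omega)) le_rfl (by exact_mod_cast ha)
    (by exact_mod_cast hd) hU hγ.le ?_ ?_ ?_ ?_ ?_ ?_ ?_
  · have e1 : (fun q => ((c₀ + n : ℤ) : ℝ) < (V q : ℝ)) = fun q => c₀ + ((n + 1 : ℕ) : ℤ) ≤ V q := by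
      ext q; rw [Int.cast_lt]; push_cast; omega
    have e2 : (fun q => ((c₀ + n - 1 : ℤ) : ℝ) < (V q : ℝ)) = fun q => c₀ + (n : ℤ) ≤ V q := by
      ext q; rw [Int.cast_lt]; omega
    rw [e1, e2] at this
    exact this
  · intro q hq m hm
    rw [Int.cast_le] at hq ⊢
    have := hja q m hm
    omega
  · intro q hq m
    rw [Int.cast_le] at hq ⊢
    have := hjd q m
    omega
  · intro q hq m hm
    rw [Int.cast_lt] at hq
    rw [Int.cast_le]
    have := hja q m hm
    omega
  · intro q hq m
    rw [Int.cast_lt] at hq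
    rw [Int.cast_le]
    have := hjd q m
    omega
  · intro q hq m hm
    rw [Int.cast_lt] at hq
    exact_mod_cast hja' q m (by omega) hm
  · intro q hq m
    rw [Int.cast_lt] at hq
    exact_mod_cast hjd' q m (by omega)
  · intro q hq hb
    rw [Int.cast_lt] at hq
    exact hdrift q (by omega) hb

/-- Exponential tail of a function of the steady state that has negative drift, changes by at most
one at each jump and does not increase at departures. -/
theorem prob_tail_real (hN : 0 < N) (hΛ : 0 ≤ Λ) (hμ : ∀ n, 0 ≤ μ n)
    (hπ : IsSteadyState Λ μ π) (V : State N b → ℝ) (bad : State N b → Prop) (c₀ : ℝ)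
    {U γ : ℝ} (hU : Λ ≤ U) (hγ : 0 < γ)
    (hja : ∀ q n, n ∈ fastestShortest μ q → V q ≤ V (arrive q n) ∧ V (arrive q n) ≤ V q + 1)
    (hjd : ∀ q n, V q - 1 ≤ V (depart q n) ∧ V (depart q n) ≤ V q)
    (hdrift : ∀ q, c₀ < V q → ¬ bad q → gen Λ μ V q ≤ -γ) (n : ℕ) :
    prob π (fun q => c₀ + 2 * n < V q) ≤
      Real.exp (-(n * (γ / (U + γ)))) + prob π bad * ((U + γ) / γ) := by
  refine geom_iterate (T := fun n : ℕ => prob π (fun q => c₀ + 2 * n < V q)) (hΛ.trans hU) hγ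
    (prob_nonneg hπ.1 _) (prob_le_one hπ.1 _) (fun n => ?_) n
  have hn : (0 : ℝ) ≤ n := n.cast_nonneg
  -- Real values need levels two apart, with `c` midway: one jump from either side does not cross
  -- `c`.
  have := prob_step_of_drift hN hΛ hμ hπ V bad (c := c₀ + 2 * n + 1)
    (l := c₀ + 2 * n) (u := c₀ + 2 * ((n + 1 : ℕ) : ℝ)) (U := U) (γ := γ) (a := 1)
    (d := 0) (by linarith) (by push_cast; linarith) zero_le_one le_rfl (by simpa using hU) hγ.le
    ?_ ?_ ?_ ?_ ?_ ?_ ?_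
  · exact this
  · intro q hq m hm
    linarith [hja q m hm]
  · intro q hq m
    linarith [hjd q m]
  · intro q hq m hm
    push_cast at hq
    linarith [hja q m hm]
  · intro q hq m
    push_cast at hq
    linarith [hjd q m]
  · intro q hq m hm
    exact (hja q m hm).2
  · intro q hq m
    linarith [hjd q m]
  · intro q hq hb
    push_cast at hq
    exact hdrift q (by linarith) hb

theorem prob_false : prob π (fun _ => False) = 0 := by simp [prob]

/-! ### Idle servers while jobs wait, and the number of jobs -/

theorem exists_idle_univ {q : State N b} (h : busy univ q < N) : ∃ n, (q n : ℕ) = 0 := by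
  obtain ⟨n, -, hn⟩ := exists_idle (G := univ) (q := q) (by simpa using h)
  exact ⟨n, hn⟩

theorem busy_univ_le (q : State N b) : busy univ q ≤ N := by simpa using busy_le_card univ q

theorem sum_sub_serviceRate_le {c : ℝ} (hμ : ∀ n, μ n ≤ c) (q : State N b) :
    ∑ n, μ n - serviceRate μ (1 ≤ ·) q ≤ c * (N - busy univ q) := by
  have e : (N : ℝ) - busy univ q = ∑ n : Fin N, if (q n : ℕ) = 0 then (1 : ℝ) else 0 := by
    have : (N : ℝ) = ∑ n : Fin N, (1 : ℝ) := by simp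
    rw [this, busy]
    push_cast
    rw [← sum_sub_distrib]
    exact sum_congr rfl fun n _ => by split_ifs <;> simp
  rw [e, serviceRate, ← sum_sub_distrib, mul_sum]
  refine sum_le_sum fun n _ => ?_
  by_cases h : (q n : ℕ) = 0
  · simp [h, hμ n]
  · simp [h, Nat.one_le_iff_ne_zero]

theorem serviceRate_le_sum (hμ : ∀ n, 0 ≤ μ n) (p : ℕ → Prop) [DecidablePred p] (q : State N b) :
    serviceRate μ p q ≤ ∑ n, μ n :=
  sum_le_sum fun n _ => by split_ifs <;> simp [hμ n]

/-- When many jobs are waiting, few servers are idle. -/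
theorem prob_idle_and_waiting_le (hN : 0 < N) (hb : 2 ≤ b) {x ε γ : ℝ} (hΛ : 0 ≤ (N : ℝ) - x)
    (hε : 0 < ε) (hμ : ∀ n, ε ≤ μ n) (hsum : ∑ n, μ n = N)
    (hπ : IsSteadyState ((N : ℝ) - x) μ π) (A₀ : ℤ) (hγ : 0 < γ) (hx : 0 ≤ x)
    (hA : ((b : ℝ) - 1) * (γ + x) ≤ ε * (A₀ + 1)) (n : ℕ) :
    prob π (fun q => (n : ℤ) ≤ min ((N : ℤ) - busy univ q) (waiting q - A₀)) ≤
      Real.exp (-(n * (γ / (N + γ)))) := by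
  have hμ0 : ∀ n, 0 ≤ μ n := fun n => hε.le.trans (hμ n)
  have hb1 : (0 : ℝ) < (b : ℝ) - 1 := by
    have : (2 : ℝ) ≤ b := by exact_mod_cast hb
    linarith
  have := prob_tail_int hN hΛ hμ0 hπ (fun q => min ((N : ℤ) - busy univ q) (waiting q - A₀))
    (fun _ => False) 0 (U := N) (γ := γ) (a := 0) (d := 1) le_rfl zero_le_one (by simp [hsum])
    hγ ?_ ?_ ?_ ?_ ?_ n
  · simpa [prob_false] using this
  · intro q m _
    have h1 := busy_arrive (by omega : 0 < b) univ q m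
    have h2 := waiting_arrive (by omega : 0 < b) q m
    split_ifs at h1 h2 <;> omega
  · intro q m
    have h1 := busy_depart univ q m
    have h2 := waiting_depart q m
    split_ifs at h1 h2 <;> omega
  · intro q m hq hm
    have h1 := busy_arrive (by omega : 0 < b) univ q m
    have h2 := waiting_arrive (by omega : 0 < b) q m
    simp only [mem_univ, true_and] at h1 hq ⊢
    by_cases hi : busy univ q < N
    · obtain ⟨l, hl⟩ := exists_idle_univ hi
      have h3 := (idle_of_mem_fastestShortest hl hm).1
      split_ifs at h1 h2 <;> omega
    · split_ifs at h1 h2 <;> omega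
  · intro q m hq
    have h1 := busy_depart univ q m
    have h2 := waiting_depart q m
    split_ifs at h1 h2 <;> omega
  · intro q hq _
    obtain ⟨l, hl⟩ := exists_idle_univ (q := q) (by omega)
    have hD : γ + x ≤ serviceRate μ (2 ≤ ·) q := by
      have h1 := mul_waiting_le hε.le hμ q
      have h2 : ((A₀ + 1 : ℤ) : ℝ) ≤ waiting q := by exact_mod_cast (by omega)
      push_cast at h2
      have h3 := mul_le_mul_of_nonneg_left h2 hε.le
      exact le_of_mul_le_mul_left (by linarith) hb1
    -- If the idle count is the minimum, arrivals lower it at rate `N - x` and only servers with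
    -- exactly one job raise it, at rate at most `N - (γ + x)`. Otherwise arrivals add no waiting
    -- job, and completions remove waiting jobs at rate at least `γ + x`.
    by_cases hc : (N : ℤ) - busy univ q ≤ waiting q - A₀
    · have := gen_le (f := fun q => ((min ((N : ℤ) - busy univ q) (waiting q - A₀) : ℤ) : ℝ))
        (q := q) hN hΛ hμ0 (a := -1) (d := fun n => if (q n : ℕ) = 1 then 1 else 0)
        (fun m hm => by
          have h1 := busy_arrive (by omega : 0 < b) univ q m
          have h3 := (idle_of_mem_fastestShortest hl hm).1
          simp only [mem_univ, true_and, if_pos h3] at h1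
          exact_mod_cast (by omega))
        (fun m => by
          have h1 := busy_depart univ q m
          have h2 := waiting_depart q m
          simp only [mem_univ, true_and] at h1
          have : min ((N : ℤ) - busy univ (depart q m)) (waiting (depart q m) - A₀) ≤
            min ((N : ℤ) - busy univ q) (waiting q - A₀) + if (q m : ℕ) = 1 then 1 else 0 := by
            split_ifs at h1 h2 ⊢ <;> omega
          exact_mod_cast this)
      have h4 := serviceRate_add μ q
      have h5 := serviceRate_le_sum hμ0 (1 ≤ ·) q
      have h6 : ∑ n, μ n * (if (q n : ℕ) = 1 then (1 : ℝ) else 0) = serviceRate μ (· = 1) q := rfl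
      rw [h6] at this
      linarith
    · have := gen_le (f := fun q => ((min ((N : ℤ) - busy univ q) (waiting q - A₀) : ℤ) : ℝ))
        (q := q) hN hΛ hμ0 (a := 0) (d := fun n => -if 2 ≤ (q n : ℕ) then 1 else 0)
        (fun m hm => by
          have h1 := busy_arrive (by omega : 0 < b) univ q m
          have h2 := waiting_arrive (by omega : 0 < b) q m
          have h3 := (idle_of_mem_fastestShortest hl hm).1
          simp only [mem_univ, true_and, if_pos h3] at h1
          rw [if_neg (by omega)] at h2
          rw [add_zero, Int.cast_le]
          omega)
        (fun m => by
          have h1 := busy_depart univ q m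
          have h2 := waiting_depart q m
          have : min ((N : ℤ) - busy univ (depart q m)) (waiting (depart q m) - A₀) ≤
            min ((N : ℤ) - busy univ q) (waiting q - A₀) + -if 2 ≤ (q m : ℕ) then 1 else 0 := by
            split_ifs at h1 h2 ⊢ <;> omega
          exact_mod_cast this)
      have h6 : ∑ n, μ n * (-if 2 ≤ (q n : ℕ) then (1 : ℝ) else 0)
          = -serviceRate μ (2 ≤ ·) q := by
        rw [serviceRate, ← sum_neg_distrib]
        exact sum_congr rfl fun n _ => by ring
      rw [h6] at this
      linarith

theorem total_arrive (hb : 0 < b) (q : State N b) (n : Fin N) :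
    total (arrive q n) = total q + if (q n : ℕ) < b then 1 else 0 := by
  have h1 := busy_arrive hb univ q n
  have h2 := waiting_arrive hb q n
  have := (q n).2
  rw [total_eq, total_eq]
  simp only [mem_univ, true_and] at h1
  split_ifs at h1 h2 ⊢ <;> omega

theorem total_depart (q : State N b) (n : Fin N) :
    total (depart q n) = total q - if 1 ≤ (q n : ℕ) then 1 else 0 := by
  have h1 := busy_depart univ q n
  have h2 := waiting_depart q n
  rw [total_eq, total_eq]
  simp only [mem_univ, true_and] at h1
  split_ifs at h1 h2 ⊢ <;> omega

/-- Arrivals at rate at most `N - x` against service at rate at least `N - x / 2` leave drift `-x /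
2`; slow service above `s₀` is the exceptional event. -/
theorem prob_total_ge_le (hN : 0 < N) (hb : 0 < b) {x : ℝ} (hΛ : 0 ≤ (N : ℝ) - x)
    (hμ : ∀ n, 0 ≤ μ n) (hx : 0 < x) (hπ : IsSteadyState ((N : ℝ) - x) μ π)
    (s₀ : ℤ) (n : ℕ) :
    prob π (fun q => s₀ + n ≤ total q) ≤ Real.exp (-(n * ((x / 2) / ((N - x) + x / 2)))) +
      prob π (fun q => s₀ < total q ∧ serviceRate μ (1 ≤ ·) q < N - x / 2) *
        (((N - x) + x / 2) / (x / 2)) := by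
  refine prob_tail_int hN hΛ hμ hπ total _ s₀ (a := 1) (d := 0) zero_le_one le_rfl (by simp)
    (by linarith) ?_ ?_ ?_ ?_ ?_ n
  · intro q m _
    have := total_arrive hb q m
    split_ifs at this <;> omega
  · intro q m
    have := total_depart q m
    split_ifs at this <;> omega
  · intro q m _ _
    have := total_arrive hb q m
    split_ifs at this <;> omega
  · intro q m _
    have := total_depart q m
    split_ifs at this <;> omega
  · intro q hq hbad
    have h1 : N - x / 2 ≤ serviceRate μ (1 ≤ ·) q := by
      by_contra! h
      exact hbad ⟨hq, h⟩
    have := gen_le (f := fun q => (total q : ℝ)) (q := q) hN hΛ hμ (a := 1)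
      (d := fun n => -if 1 ≤ (q n : ℕ) then 1 else 0)
      (fun m _ => by
        have h2 := total_arrive hb q m
        have : total (arrive q m) ≤ total q + 1 := by split_ifs at h2 <;> omega
        exact_mod_cast this)
      (fun m => by
        have h2 := total_depart q m
        have : total (depart q m) ≤ total q + -if 1 ≤ (q m : ℕ) then 1 else 0 := by
          split_ifs at h2 ⊢ <;> omega
        exact_mod_cast this)
    have h6 : ∑ n, μ n * (-if 1 ≤ (q n : ℕ) then (1 : ℝ) else 0)
        = -serviceRate μ (1 ≤ ·) q := by
      rw [serviceRate, ← sum_neg_distrib]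
      exact sum_congr rfl fun n _ => by ring
    rw [h6] at this
    linarith

/-! ### From tails to moments -/

/-- With `y = φ * j / r` this is the `r`-th power of `y ≤ exp (y - 1) ≤ exp y / 2`. -/
theorem pow_le_mul_exp {φ : ℝ} (hφ : 0 < φ) {r : ℕ} (hr : 0 < r) (j : ℕ) :
    (j : ℝ) ^ r ≤ (r / (2 * φ)) ^ r * Real.exp (φ * j) := by
  have hr' : (0 : ℝ) < r := by exact_mod_cast hr
  have h1 : (j : ℝ) ≤ r / (2 * φ) * Real.exp (φ * j / r) := by
    have h2 := Real.add_one_le_exp (φ * j / r - 1)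
    have h3 : Real.exp (φ * j / r - 1) ≤ Real.exp (φ * j / r) / 2 := by
      rw [Real.exp_sub]
      have := Real.exp_one_gt_d9
      exact div_le_div_of_nonneg_left (Real.exp_pos _).le (by norm_num) (by linarith)
    have h4 : (j : ℝ) = r / φ * (φ * j / r) := by field_simp
    have h5 : r / (2 * φ) * Real.exp (φ * j / r) = r / φ * (Real.exp (φ * j / r) / 2) := by
      field_simp
    rw [h5]
    nth_rewrite 1 [h4]
    exact mul_le_mul_of_nonneg_left (by linarith) (by positivity)
  calc (j : ℝ) ^ r ≤ (r / (2 * φ) * Real.exp (φ * j / r)) ^ r :=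
        pow_le_pow_left₀ (by positivity) h1 r
    _ = _ := by
      rw [mul_pow, ← Real.exp_nat_mul]
      congr 2
      field_simp

theorem sum_sub_mul_pow (a : ℕ → ℝ) (h0 : a 0 = 0) (t : ℝ) (M : ℕ) :
    ∑ j ∈ range M, (a (j + 1) - a j) * t ^ (j + 1) =
      a M * t ^ (M + 1) + (1 - t) * ∑ j ∈ range M, a (j + 1) * t ^ (j + 1) := by
  induction M with
  | zero => simp [h0]
  | succ M ih => rw [sum_range_succ, ih, sum_range_succ]; ring

/-- Half of the exponential rate `2 * φ` absorbs the power `j ^ r`; the other half leaves a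
geometric series in `τ`. After summation by parts the boundary term costs one `C` and the series,
weighted by `1 - τ ^ 2`, costs two. -/
theorem sum_pow_sub_mul_le {φ β : ℝ} (hφ : 0 < φ) {r : ℕ} (hr : 0 < r) (M : ℕ) {T : ℕ → ℝ}
    (hT : ∀ n, T n ≤ Real.exp (-(n * (2 * φ))) + β) :
    ∑ j ∈ range M, (((j + 1 : ℕ) : ℝ) ^ r - (j : ℝ) ^ r) * T (j + 1) ≤
      3 * (r / (2 * φ)) ^ r + M ^ r * β := by
  have hC : 0 ≤ ((r : ℝ) / (2 * φ)) ^ r := by positivity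
  set C := ((r : ℝ) / (2 * φ)) ^ r with hCdef
  set τ := Real.exp (-φ) with hτ
  have hτ0 : 0 < τ := Real.exp_pos _
  have hτ1 : τ < 1 := by rw [hτ, ← Real.exp_zero]; exact Real.exp_lt_exp.2 (by linarith)
  have hexp : ∀ n : ℕ, Real.exp (-(n * (2 * φ))) = (τ ^ 2) ^ n := fun n => by
    rw [hτ, ← pow_mul, ← Real.exp_nat_mul]; congr 1; push_cast; ring
  have hpow : ∀ j : ℕ, (j : ℝ) ^ r * (τ ^ 2) ^ j ≤ C * τ ^ j := fun j => by
    have h1 := mul_le_mul_of_nonneg_right (pow_le_mul_exp hφ hr j) (by positivity : 0 ≤ (τ ^ 2) ^ j)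
    have h2 : Real.exp (φ * j) * (τ ^ 2) ^ j = τ ^ j := by
      rw [hτ, ← pow_mul, ← Real.exp_nat_mul, ← Real.exp_nat_mul, ← Real.exp_add]
      congr 1; push_cast; ring
    rwa [mul_assoc, h2] at h1
  have hstep : ∀ j : ℕ, 0 ≤ ((j + 1 : ℕ) : ℝ) ^ r - (j : ℝ) ^ r := fun j => by
    rw [sub_nonneg]
    exact pow_le_pow_left₀ (by positivity) (by push_cast; linarith) r
  have h1 : ∑ j ∈ range M, (((j + 1 : ℕ) : ℝ) ^ r - (j : ℝ) ^ r) * T (j + 1) ≤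
      ∑ j ∈ range M, (((j + 1 : ℕ) : ℝ) ^ r - (j : ℝ) ^ r) * (τ ^ 2) ^ (j + 1)
      + (∑ j ∈ range M, (((j + 1 : ℕ) : ℝ) ^ r - (j : ℝ) ^ r)) * β := by
    rw [sum_mul, ← sum_add_distrib]
    refine sum_le_sum fun j _ => ?_
    rw [← mul_add, ← hexp]
    exact mul_le_mul_of_nonneg_left (hT _) (hstep j)
  rw [sum_range_sub (fun j : ℕ => (j : ℝ) ^ r), sum_sub_mul_pow (fun j : ℕ => (j : ℝ) ^ r)
    (by simp [hr.ne'])] at h1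
  have h2 : ∑ j ∈ range M, ((j + 1 : ℕ) : ℝ) ^ r * (τ ^ 2) ^ (j + 1) ≤ C * (τ / (1 - τ)) := by
    calc _ ≤ ∑ j ∈ range M, C * τ ^ (j + 1) := sum_le_sum fun j _ => hpow (j + 1)
      _ = C * (τ * ∑ j ∈ range M, τ ^ j) := by
        rw [mul_sum, mul_sum]; exact sum_congr rfl fun j _ => by ring
      _ ≤ C * (τ * (1 - τ)⁻¹) := by
        gcongr
        rw [← tsum_geometric_of_lt_one hτ0.le hτ1]
        exact (summable_geometric_of_lt_one hτ0.le hτ1).sum_le_tsum _ (fun _ _ => by positivity)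
      _ = _ := by rw [div_eq_mul_inv]
  have h3 : (1 - τ ^ 2) * ∑ j ∈ range M, ((j + 1 : ℕ) : ℝ) ^ r * (τ ^ 2) ^ (j + 1) ≤ 2 * C := by
    calc _ ≤ (1 - τ ^ 2) * (C * (τ / (1 - τ))) :=
          mul_le_mul_of_nonneg_left h2 (by nlinarith)
      _ = C * (τ * (1 + τ)) := by
          have : 1 - τ ≠ 0 := by linarith
          field_simp
          ring
      _ ≤ C * 2 := mul_le_mul_of_nonneg_left (by nlinarith) hC
      _ = _ := by ring
  have h4 : (M : ℝ) ^ r * (τ ^ 2) ^ (M + 1) ≤ C := by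
    calc _ = (M : ℝ) ^ r * (τ ^ 2) ^ M * τ ^ 2 := by ring
      _ ≤ C * τ ^ M * τ ^ 2 := mul_le_mul_of_nonneg_right (hpow M) (by positivity)
      _ = C * τ ^ (M + 2) := by ring
      _ ≤ C * 1 := mul_le_mul_of_nonneg_left (pow_le_one₀ hτ0.le hτ1.le) hC
      _ = C := mul_one C
  have h5 : ((0 : ℕ) : ℝ) ^ r = 0 := by simp [hr.ne']
  rw [h5, sub_zero] at h1
  linarith

theorem pow_eq_sum_indicator {r : ℕ} (hr : 0 < r) {y M : ℕ} (hy : y ≤ M) :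
    (y : ℝ) ^ r = ∑ j ∈ range M, (((j + 1 : ℕ) : ℝ) ^ r - (j : ℝ) ^ r) *
      if j + 1 ≤ y then 1 else 0 := by
  have h := sum_range_sub (fun j : ℕ => (j : ℝ) ^ r) y
  simp only [Nat.cast_zero, ne_eq, hr.ne', not_false_eq_true, zero_pow, sub_zero] at h
  rw [← h, ← sum_subset (range_mono hy)]
  · refine sum_congr rfl fun j hj => ?_
    rw [if_pos (by simpa using hj), mul_one]
  · intro j _ hj
    rw [if_neg (by simpa using hj), mul_zero]

theorem expect_pow_eq {r : ℕ} (hr : 0 < r) (V : State N b → ℕ) {M : ℕ} (hV : ∀ q, V q ≤ M) :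
    expect π (fun q => (V q : ℝ) ^ r) =
      ∑ j ∈ range M, (((j + 1 : ℕ) : ℝ) ^ r - (j : ℝ) ^ r) * prob π (fun q => j + 1 ≤ V q) := by
  classical
  unfold expect prob
  simp_rw [mul_sum]
  rw [sum_comm]
  refine sum_congr rfl fun q _ => ?_
  rw [pow_eq_sum_indicator hr (hV q), mul_sum]
  refine sum_congr rfl fun j _ => ?_
  split_ifs <;> ring

theorem expect_mono (hπ : π ∈ stdSimplex ℝ (State N b)) {f g : State N b → ℝ}
    (h : ∀ q, f q ≤ g q) : expect π f ≤ expect π g :=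
  sum_le_sum fun q _ => mul_le_mul_of_nonneg_left (h q) (hπ.1 q)

theorem one_le_of_sum_eq (hN : 0 < N) {c : ℝ} (hμ : ∀ n, μ n ≤ c) (hsum : ∑ n, μ n = N) :
    1 ≤ c := by
  have h : ∑ n, μ n ≤ ∑ _n : Fin N, c := sum_le_sum fun n _ => hμ n
  rw [hsum, sum_const, card_univ, Fintype.card_fin, nsmul_eq_mul] at h
  have : (0 : ℝ) < N := by exact_mod_cast hN
  nlinarith

theorem avgQueue_eq (q : State N b) : avgQueue q = (total q : ℝ) / N := by
  unfold avgQueue total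
  push_cast
  ring

/-! ### The moment bound for small spare capacity -/

/-- A service rate below `N - x / 2` needs at least `x / (2 * μ₁)` idle servers, while more than `N
+ A₀` jobs make the waiting excess larger than the idle count. So the minimum of the two is large.
-/
theorem prob_slow_service_le (hN : 2 ≤ N) (hb : 2 ≤ b) {r : ℕ} {x ε μ₁ ℓ : ℝ}
    (hε : 0 < ε) (hμ : ∀ n, ε ≤ μ n) (hμ₁ : ∀ n, μ n ≤ μ₁) (hsum : ∑ n, μ n = N)
    (hx : 0 < x) (hΛ : 0 ≤ (N : ℝ) - x) (hπ : IsSteadyState ((N : ℝ) - x) μ π)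
    (hγN : 8 * r * μ₁ * ℓ ≤ x) (hγx : x ^ 2 ≤ 16 * r * μ₁ * N * ℓ) (hℓ : 0 < ℓ) (hr : 0 < r)
    (A₀ : ℤ) (hA : 24 * r * ((b : ℝ) - 1) * μ₁ / ε * ℓ / x * N ≤ A₀ + 1) :
    prob π (fun q => N + A₀ < total q ∧ serviceRate μ (1 ≤ ·) q < N - x / 2) ≤
      Real.exp (-(2 * r * ℓ)) := by
  have hN0 : 0 < N := by omega
  have hNR : (0 : ℝ) < N := by exact_mod_cast hN0
  have hrR : (0 : ℝ) < r := by exact_mod_cast hr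
  have hμ1 : 1 ≤ μ₁ := one_le_of_sum_eq hN0 hμ₁ hsum
  have hμ1' : 0 < μ₁ := by linarith
  have hb1 : (0 : ℝ) < (b : ℝ) - 1 := by
    have : (2 : ℝ) ≤ b := by exact_mod_cast hb
    linarith
  -- Chosen so that `x / (2 * μ₁) * (γ / (2 * N)) = 2 * r * ℓ`.
  set γ : ℝ := 8 * r * μ₁ * N * ℓ / x with hγdef
  have hγ : 0 < γ := by positivity
  have hx2 : x ≤ 2 * γ := by
    rw [hγdef, mul_div_assoc', le_div_iff₀ hx]
    nlinarith
  have hγN' : γ ≤ N := by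
    rw [hγdef, div_le_iff₀ hx]
    nlinarith
  have hA' : ((b : ℝ) - 1) * (γ + x) ≤ ε * (A₀ + 1) := by
    have h1 : ε * (24 * r * ((b : ℝ) - 1) * μ₁ / ε * ℓ / x * N) = ((b : ℝ) - 1) * (3 * γ) := by
      rw [hγdef]; field_simp; ring
    have h2 := mul_le_mul_of_nonneg_left hA hε.le
    rw [h1] at h2
    refine le_trans ?_ h2
    exact mul_le_mul_of_nonneg_left (by linarith) hb1.le
  refine le_trans (prob_mono hπ.1 ?_) ((prob_idle_and_waiting_le hN0 hb hΛ hε hμ hsum hπ A₀ hγ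
    hx.le hA' ⌈x / (2 * μ₁)⌉₊).trans ?_)
  · rintro q ⟨h1, h2⟩
    have h3 := sum_sub_serviceRate_le hμ₁ q
    rw [hsum] at h3
    have h4 : x / (2 * μ₁) ≤ (N : ℝ) - busy univ q := by
      rw [div_le_iff₀ (by positivity)]
      nlinarith
    have h5 := busy_univ_le q
    have h6 : ((⌈x / (2 * μ₁)⌉₊ : ℕ) : ℤ) ≤ (N : ℤ) - busy univ q := by
      obtain ⟨k, hk⟩ := Int.eq_ofNat_of_zero_le (sub_nonneg.2 h5)
      rw [hk, Nat.cast_le, Nat.ceil_le]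
      have : ((N : ℤ) - busy univ q : ℤ) = ((k : ℤ) : ℝ) := by rw [hk]
      push_cast at this
      linarith
    rw [total_eq] at h1
    omega
  · rw [Real.exp_le_exp, neg_le_neg_iff]
    calc 2 * r * ℓ = x / (2 * μ₁) * (γ / (N + N)) := by rw [hγdef]; field_simp; ring
      _ ≤ ⌈x / (2 * μ₁)⌉₊ * (γ / (N + γ)) := by
        gcongr
        exact Nat.le_ceil _

theorem spare_capacity_bounds {N b r x ε μ₁ ℓ : ℝ} (hb : 2 ≤ b) (hr : 1 ≤ r) (hμ₁ : 1 ≤ μ₁)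
    (hε1 : ε ≤ 1) (hℓ : 0.69 ≤ ℓ) (hx : 0 < x) (hxN : x ^ 2 ≤ N)
    (hcond : 24 * r * b * ℓ ^ 2 * μ₁ ≤ x * ε) :
    b ≤ x ∧ b * x ≤ N ∧ x ≤ N ∧ 8 * r * μ₁ * ℓ ≤ x ∧ x ^ 2 ≤ 16 * r * μ₁ * N * ℓ := by
  have hℓ2 : 0.69 * ℓ ≤ ℓ ^ 2 := by nlinarith
  have hxε : x * ε ≤ x := by nlinarith
  have hμr : 1 ≤ r * μ₁ := by nlinarith
  have hbx : b ≤ x := by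
    refine le_trans ?_ (hcond.trans hxε)
    have h1 : (0.4 : ℝ) ≤ ℓ ^ 2 := by nlinarith
    have h2 : 0.4 * 1 ≤ ℓ ^ 2 * (r * μ₁) := by
      apply mul_le_mul h1 hμr zero_le_one (by positivity)
    nlinarith
  refine ⟨hbx, by nlinarith, by nlinarith, ?_, ?_⟩
  · refine le_trans ?_ (hcond.trans hxε)
    have h1 : ℓ ≤ 3 * (b * ℓ ^ 2) := by nlinarith
    have h2 := mul_le_mul_of_nonneg_left h1 (by positivity : 0 ≤ 8 * (r * μ₁))
    linarith
  · have h1 : 1 ≤ 16 * ℓ * (r * μ₁) := by nlinarith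
    nlinarith

set_option maxHeartbeats 1000000 in
/-- The moment bound in the regime `x ^ 2 ≤ N`, where `x` is the spare capacity. -/
theorem expect_le_of_sq_le (hN : 2 ≤ N) (hb : 2 ≤ b) {r : ℕ} (hr : 0 < r) {x ε μ₁ : ℝ}
    (hε : 0 < ε) (hμ : ∀ n, ε ≤ μ n) (hμ₁ : ∀ n, μ n ≤ μ₁) (hsum : ∑ n, μ n = N)
    (hx : 0 < x) (hxN : x ^ 2 ≤ N) (hπ : IsSteadyState ((N : ℝ) - x) μ π)
    (hcond : μ₁ / ε ≤ x / (24 * r * b * Real.log N ^ 2)) :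
    expect π (fun q => (max (avgQueue q - 1
      - 24 * r * ((b : ℝ) - 1) * μ₁ / ε * Real.log N / x) 0) ^ r) ≤ 10 * (2 * r / x) ^ r := by
  have hN0 : 0 < N := by omega
  have hNR : (0 : ℝ) < N := by exact_mod_cast hN0
  have hN1 : (1 : ℝ) ≤ N := by exact_mod_cast hN0
  have hrR : (1 : ℝ) ≤ r := by exact_mod_cast hr
  have hbR : (2 : ℝ) ≤ b := by exact_mod_cast hb
  have hμ1 : 1 ≤ μ₁ := one_le_of_sum_eq hN0 hμ₁ hsum
  have hμ0 : ∀ n, 0 ≤ μ n := fun n => hε.le.trans (hμ n)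
  have hε1 : ε ≤ 1 := by
    have h : ∑ _n : Fin N, ε ≤ ∑ n, μ n := sum_le_sum fun n _ => hμ n
    rw [hsum, sum_const, card_univ, Fintype.card_fin, nsmul_eq_mul] at h
    nlinarith
  set ℓ := Real.log N with hℓdef
  have hℓ : 0.69 ≤ ℓ := by
    have h1 := Real.log_le_log (by norm_num) (by exact_mod_cast hN : (2 : ℝ) ≤ N)
    have h2 := Real.log_two_gt_d9
    linarith
  have hcond' : 24 * r * b * ℓ ^ 2 * μ₁ ≤ x * ε := by
    rw [div_le_div_iff₀ hε (by positivity)] at hcond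
    linarith
  obtain ⟨hbx, hbx', hxN', hγN, hγx⟩ :=
    spare_capacity_bounds hbR hrR hμ1 hε1 hℓ hx hxN hcond'
  have hx1 : 2 ≤ x := hbR.trans hbx
  set K := 24 * r * ((b : ℝ) - 1) * μ₁ / ε * ℓ / x with hK
  set A₀ : ℤ := ⌊K * N⌋ with hA₀
  have hbad := prob_slow_service_le hN hb hε hμ hμ₁ hsum hx (by linarith) hπ hγN hγx
    (by linarith) hr A₀ (Int.lt_floor_add_one _).le
  set p := prob π (fun q => N + A₀ < total q ∧ serviceRate μ (1 ≤ ·) q < N - x / 2) with hp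
  have hp0 : 0 ≤ p := prob_nonneg hπ.1 _
  have hpN : p ≤ 1 / ((N : ℝ) ^ r * (N : ℝ) ^ r) := by
    refine hbad.trans (le_of_eq ?_)
    rw [Real.exp_neg, one_div, ← pow_add]
    congr 1
    rw [show 2 * (r : ℝ) * ℓ = ((r + r : ℕ) : ℝ) * ℓ by push_cast; ring, Real.exp_nat_mul, hℓdef,
      Real.exp_log hNR]
  have htail : ∀ n : ℕ, prob π (fun q => (N : ℤ) + A₀ + n ≤ total q) ≤
      Real.exp (-(n * (2 * (x / (4 * N))))) + p * (2 * N / x) := by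
    intro n
    refine (prob_total_ge_le hN0 (by omega) (by linarith) hμ0 hx hπ (N + A₀) n).trans ?_
    have h1 : (N : ℝ) - x + x / 2 ≤ N := by linarith
    have h2 : 0 < (N : ℝ) - x + x / 2 := by linarith
    refine add_le_add ?_ (mul_le_mul_of_nonneg_left ?_ hp0)
    · rw [Real.exp_le_exp, neg_le_neg_iff]
      refine mul_le_mul_of_nonneg_left ?_ n.cast_nonneg
      calc 2 * (x / (4 * N)) = x / 2 / N := by field_simp; norm_num
        _ ≤ _ := by gcongr
    · calc ((N : ℝ) - x + x / 2) / (x / 2) ≤ N / (x / 2) := by gcongr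
        _ = _ := by field_simp
  have hmom := sum_pow_sub_mul_le (φ := x / (4 * N)) (by positivity) hr (b * N)
    (T := fun n : ℕ => prob π (fun q => (N : ℤ) + A₀ + n ≤ total q)) htail
  have hY : expect π (fun q => (((total q - (N + A₀)).toNat : ℕ) : ℝ) ^ r) ≤
      10 * (2 * r * N / x) ^ r := by
    have hK0 : 0 ≤ K := by
      have : (0 : ℝ) ≤ (b : ℝ) - 1 := by linarith
      have : 0 ≤ ℓ := by linarith
      positivity
    have hA₀0 : 0 ≤ A₀ := Int.floor_nonneg.2 (by positivity)
    rw [expect_pow_eq hr (fun q => (total q - (N + A₀)).toNat) (M := b * N) (fun q => by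
      have := total_le q
      have h2 : ((b * N : ℕ) : ℤ) = b * N := by push_cast; ring
      omega)]
    have e : ∀ j : ℕ, (fun q : State N b => j + 1 ≤ (total q - (N + A₀)).toNat) =
        fun q => (N : ℤ) + A₀ + ((j + 1 : ℕ) : ℤ) ≤ total q := fun j => by
      ext q; push_cast; omega
    simp_rw [e]
    refine hmom.trans ?_
    have h1 : (r : ℝ) / (2 * (x / (4 * N))) = 2 * r * N / x := by field_simp; norm_num
    rw [h1]
    -- The error `p ≤ N ^ (-2 r)` outweighs the trivial bound `(b * N) ^ r` on the variable and the
    -- factor `2 * N / x ≤ N`.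
    have h2 : ((b * N : ℕ) : ℝ) ^ r * (p * (2 * N / x)) ≤ (2 * r * N / x) ^ r := by
      have h3 : ((b * N : ℕ) : ℝ) ≤ N * (N / x) := by
        push_cast
        rw [← mul_div_assoc, le_div_iff₀ hx]
        nlinarith
      have h4 : 2 * N / x ≤ (N : ℝ) ^ r := by
        calc 2 * N / x ≤ N := by rw [div_le_iff₀ hx]; nlinarith
          _ = (N : ℝ) ^ 1 := (pow_one _).symm
          _ ≤ _ := pow_le_pow_right₀ hN1 hr
      calc ((b * N : ℕ) : ℝ) ^ r * (p * (2 * N / x))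
          ≤ (N * (N / x)) ^ r * (1 / ((N : ℝ) ^ r * (N : ℝ) ^ r) * (N : ℝ) ^ r) := by gcongr
        _ = (N / x) ^ r := by rw [mul_pow]; field_simp
        _ ≤ (2 * r * N / x) ^ r := by
          gcongr
          nlinarith
    have h5 : 0 ≤ (2 * r * N / x) ^ r := by positivity
    linarith
  have hle : ∀ q : State N b, (max (avgQueue q - 1 - K) 0) ^ r ≤
      (1 / (N : ℝ) ^ r) * (((total q - (N + A₀)).toNat : ℕ) : ℝ) ^ r := by
    intro q
    rw [← one_div_pow, ← mul_pow]
    refine pow_le_pow_left₀ (le_max_right _ _) (max_le ?_ (by positivity)) r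
    rw [avgQueue_eq, one_div, inv_mul_eq_div, le_div_iff₀ hNR]
    have h1 : ((total q - (N + A₀) : ℤ) : ℝ) ≤ (((total q - (N + A₀)).toNat : ℕ) : ℝ) := by
      exact_mod_cast Int.self_le_toNat _
    have h2 : (A₀ : ℝ) ≤ K * N := Int.floor_le _
    push_cast at h1
    have h3 : ((total q : ℝ) / N - 1 - K) * N = total q - N - K * N := by field_simp
    linarith
  calc _ ≤ expect π (fun q => (1 / (N : ℝ) ^ r) * (((total q - (N + A₀)).toNat : ℕ) : ℝ) ^ r) :=
        expect_mono hπ.1 hle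
    _ = (1 / (N : ℝ) ^ r) * expect π (fun q => (((total q - (N + A₀)).toNat : ℕ) : ℝ) ^ r) := by
        unfold expect
        rw [mul_sum]
        exact sum_congr rfl fun q _ => by ring
    _ ≤ (1 / (N : ℝ) ^ r) * (10 * (2 * r * N / x) ^ r) := by gcongr
    _ = _ := by rw [← one_div_pow, mul_left_comm, ← mul_pow]; congr 2; field_simp

/-! ### Deficits of busy fast servers -/

/-- Subtract `μ i` from every rate: the excesses in the level set are nonnegative and vanish beyond
`i`, so the busy ones add up to at most the sum over `Iic i`. The deficit therefore slows the
departures by `μ i` per missing server. -/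
theorem sum_busy_le (hμ : Antitone μ) (i : Fin N) (q : State N b) :
    ∑ n ∈ univ.filter (fun n => μ i ≤ μ n), μ n * (if (q n : ℕ) = 0 then 0 else 1) ≤
      ∑ n ∈ Iic i, μ n - μ i * ((i : ℕ) + 1 - busy (univ.filter (fun n => μ i ≤ μ n)) q) := by
  set G := univ.filter (fun n => μ i ≤ μ n) with hG
  have hsub : Iic i ⊆ G := fun n hn => by
    simp only [hG, mem_filter, mem_univ, true_and]
    exact hμ (mem_Iic.1 hn)
  have h1 : ∑ n ∈ G, (μ n - μ i) * (if (q n : ℕ) = 0 then (0 : ℝ) else 1) ≤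
      ∑ n ∈ Iic i, (μ n - μ i) := by
    have e : ∑ n ∈ Iic i, (μ n - μ i) = ∑ n ∈ G, if n ≤ i then μ n - μ i else 0 := by
      refine sum_subset_zero_on_sdiff hsub (fun n hn => ?_) fun n hn => ?_
      · rw [mem_sdiff, mem_Iic] at hn
        rw [if_neg hn.2]
      · rw [if_pos (mem_Iic.1 hn)]
    rw [e]
    refine sum_le_sum fun n hn => ?_
    have hn' : μ i ≤ μ n := by simpa [hG] using hn
    by_cases h2 : n ≤ i
    · rw [if_pos h2]
      split_ifs
      · simpa using hn'
      · simp
    · have := hμ (not_le.1 h2).le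
      rw [if_neg h2, le_antisymm this hn']
      simp
  have h2 : (busy G q : ℝ) = ∑ n ∈ G, if (q n : ℕ) = 0 then (0 : ℝ) else 1 := by
    unfold busy; push_cast; rfl
  have h3 : ((Iic i).card : ℝ) = (i : ℕ) + 1 := by rw [Fin.card_Iic]; push_cast; ring
  rw [sum_sub_distrib, sum_const, nsmul_eq_mul, h3] at h1
  simp only [sub_mul, sum_sub_distrib] at h1
  rw [← mul_sum, ← h2] at h1
  linarith

/-- The number of busy servers among those at least as fast as server `i` rarely falls far below
its value when the first `i + 1` servers are busy. -/
theorem prob_deficit_le (hN : 0 < N) (hb : 0 < b) (hμ0 : ∀ n, 0 ≤ μ n) (hμ : Antitone μ)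
    (hsum : ∑ n, μ n = N) (hΛ : 0 ≤ Λ) (hπ : IsSteadyState Λ μ π) (i : Fin N) (c₀ : ℕ) {γ : ℝ}
    (hγ : 0 < γ) (hγ' : γ ≤ Λ - ∑ n ∈ Iic i, μ n + μ i * (c₀ + 1)) (n : ℕ) :
    prob π (fun q => (c₀ : ℤ) + n ≤ ((i : ℕ) : ℤ) + 1 -
      busy (univ.filter (fun n => μ i ≤ μ n)) q) ≤ Real.exp (-(n * (γ / (N + γ)))) := by
  set G := univ.filter (fun n => μ i ≤ μ n) with hG
  have hcard : (i : ℕ) + 1 ≤ G.card := by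
    rw [← Fin.card_Iic]
    exact card_le_card fun n hn => by
      simp only [hG, mem_filter, mem_univ, true_and]
      exact hμ (mem_Iic.1 hn)
  have := prob_tail_int hN hΛ hμ0 hπ (fun q => ((i : ℕ) : ℤ) + 1 - busy G q)
    (fun _ => False) c₀ (U := N) (γ := γ) (a := 0) (d := 1) le_rfl zero_le_one (by simp [hsum])
    hγ ?_ ?_ ?_ ?_ ?_ n
  · simpa [prob_false] using this
  · intro q m _
    have h1 := busy_arrive hb G q m
    split_ifs at h1 <;> omega
  · intro q m
    have h1 := busy_depart G q m
    split_ifs at h1 <;> omega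
  · intro q m _ _
    have h1 := busy_arrive hb G q m
    split_ifs at h1 <;> omega
  · intro q m _
    have h1 := busy_depart G q m
    split_ifs at h1 <;> omega
  · intro q hq _
    obtain ⟨l, hl, hl0⟩ := exists_idle (G := G) (q := q) (by omega)
    have := gen_le (f := fun q => ((((i : ℕ) : ℤ) + 1 - busy G q : ℤ) : ℝ)) (q := q) hN hΛ hμ0
      (a := -1) (d := fun n => if n ∈ G ∧ (q n : ℕ) = 1 then 1 else 0)
      (fun m hm => by
        have h1 := busy_arrive hb G q m
        have h3 := idle_of_mem_fastestShortest hl0 hm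
        have h4 : m ∈ G := by
          simp only [hG, mem_filter, mem_univ, true_and] at hl ⊢
          exact hl.trans h3.2
        rw [if_pos ⟨h4, h3.1⟩] at h1
        exact_mod_cast (by omega))
      (fun m => by
        have h1 := busy_depart G q m
        have : ((i : ℕ) : ℤ) + 1 - busy G (depart q m) ≤
          ((i : ℕ) : ℤ) + 1 - busy G q + if m ∈ G ∧ (q m : ℕ) = 1 then 1 else 0 := by
          split_ifs at h1 ⊢ <;> omega
        exact_mod_cast this)
    have h5 : ∑ n, μ n * (if n ∈ G ∧ (q n : ℕ) = 1 then (1 : ℝ) else 0) ≤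
        ∑ n ∈ G, μ n * (if (q n : ℕ) = 0 then 0 else 1) := by
      rw [← sum_subset (subset_univ G) (f := fun n => μ n * (if n ∈ G ∧ (q n : ℕ) = 1 then 1 else 0))]
      · refine sum_le_sum fun m hm => mul_le_mul_of_nonneg_left ?_ (hμ0 m)
        by_cases h0 : (q m : ℕ) = 0
        · simp [h0]
        · rw [if_neg h0]; split_ifs <;> simp
      · intro m _ hm
        simp [hm]
    have h6 := sum_busy_le hμ i q
    have h7 : ((c₀ + 1 : ℤ) : ℝ) ≤ ((((i : ℕ) : ℤ) + 1 - busy G q : ℤ) : ℝ) := by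
      exact_mod_cast (by omega)
    push_cast at h7
    have h8 := mul_le_mul_of_nonneg_left h7 (hμ0 i)
    linarith

/-! ### From deficits to the service rate -/

/-- The left side telescopes to `ν k` for the first `k ≤ t` with `ν k ≤ y`, and is `ε` if there is
none. -/
theorem levels_le (ν : ℕ → ℝ) (hν : Antitone ν) {ε y : ℝ} (hy : ε ≤ y) (t : ℕ) :
    ε + (ν t - ε) * (if ν t ≤ y then 1 else 0) +
      ∑ k ∈ range t, (ν k - ν (k + 1)) * (if ν k ≤ y then 1 else 0) ≤ y := by
  induction t with
  | zero => simp only [range_zero, sum_empty]; split_ifs <;> linarith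
  | succ t ih =>
    by_cases h : ν t ≤ y
    · have h' : ν (t + 1) ≤ y := (hν t.le_succ).trans h
      rw [sum_range_succ]
      simp only [h, h', if_true] at ih ⊢
      linarith
    · rw [sum_eq_zero]
      · split_ifs <;> linarith
      · intro k hk
        have : ν t ≤ ν k := hν (by simpa [Nat.lt_succ_iff] using hk)
        rw [if_neg (by linarith), mul_zero]

theorem sum_levels (ν : ℕ → ℝ) (t : ℕ) :
    ν t * (t + 1) + ∑ k ∈ range t, (ν k - ν (k + 1)) * (k + 1) = ∑ k ∈ range (t + 1), ν k := by
  induction t with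
  | zero => simp
  | succ t ih => rw [sum_range_succ, sum_range_succ _ (t + 1), ← ih]; push_cast; ring

/-- A lower bound for the service rate when no level set of fast servers has many idle servers. -/
theorem le_serviceRate {ν : ℕ → ℝ} (hν : Antitone ν) {ε : ℝ} (hε : ∀ k, ε ≤ ν k)
    (hμ : ∀ n, ε ≤ μ n) {K Ψ : ℝ → ℝ} (hε0 : 0 ≤ ε) (hK : ∀ y, 0 ≤ K y)
    (hΨ : ∀ y z, ε ≤ z → z ≤ y → (y - z) * K y ≤ Ψ y - Ψ z) (hΨ' : ∀ y, ε ≤ y → y * K y ≤ Ψ y)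
    {q : State N b} {t : ℕ}
    (hq : ∀ k ≤ t, (k : ℝ) + 1 - busy (univ.filter (fun n => ν k ≤ μ n)) q ≤ K (ν k)) :
    ∑ k ∈ range (t + 1), ν k + ε * (busy univ q - (t + 1)) - Ψ (ν 0) ≤
      serviceRate μ (1 ≤ ·) q := by
  set β : Fin N → ℝ := fun n => if (q n : ℕ) = 0 then 0 else 1 with hβ
  have hβ0 : ∀ n, 0 ≤ β n := fun n => by simp only [hβ]; split_ifs <;> simp
  have hbusy : ∀ k, (busy (univ.filter (fun n => ν k ≤ μ n)) q : ℝ) =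
      ∑ n, β n * (if ν k ≤ μ n then 1 else 0) := fun k => by
    unfold busy
    push_cast
    rw [sum_filter]
    exact sum_congr rfl fun n _ => by simp only [hβ]; split_ifs <;> simp
  have hbusy' : (busy univ q : ℝ) = ∑ n, β n := by unfold busy; push_cast; rfl
  have h1 : ε * busy univ q + (ν t - ε) * busy (univ.filter (fun n => ν t ≤ μ n)) q +
      ∑ k ∈ range t, (ν k - ν (k + 1)) * busy (univ.filter (fun n => ν k ≤ μ n)) q ≤
      serviceRate μ (1 ≤ ·) q := by
    have h2 := sum_le_sum fun n (_ : n ∈ univ) =>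
      mul_le_mul_of_nonneg_left (levels_le ν hν (hμ n) t) (hβ0 n)
    have e1 : ∑ n, β n * μ n = serviceRate μ (1 ≤ ·) q := by
      unfold serviceRate
      refine sum_congr rfl fun n _ => ?_
      simp only [hβ, Nat.one_le_iff_ne_zero]
      split_ifs <;> simp_all
    rw [e1] at h2
    refine le_trans (le_of_eq ?_) h2
    simp only [mul_add, sum_add_distrib, hbusy, hbusy', mul_sum]
    congr 1
    · congr 1
      · exact sum_congr rfl fun n _ => mul_comm _ _
      · exact sum_congr rfl fun n _ => by ring
    · rw [sum_comm]
      exact sum_congr rfl fun n _ => sum_congr rfl fun k _ => by ring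
  have h3 : ∀ k ≤ t, ∀ c : ℝ, 0 ≤ c →
      c * (k + 1) - c * K (ν k) ≤ c * busy (univ.filter (fun n => ν k ≤ μ n)) q :=
    fun k hk c hc => by
      have := mul_le_mul_of_nonneg_left (hq k hk) hc
      linarith
  -- `Ψ` acts as an antiderivative of the tolerance `K`, so the losses telescope; `hΨ'` pays for the
  -- last level.
  have h4 : ∑ k ∈ range t, (ν k - ν (k + 1)) * (k + 1) - (Ψ (ν 0) - Ψ (ν t)) ≤
      ∑ k ∈ range t, (ν k - ν (k + 1)) * busy (univ.filter (fun n => ν k ≤ μ n)) q := by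
    rw [← sum_range_sub' (fun k => Ψ (ν k)), ← sum_sub_distrib]
    refine sum_le_sum fun k hk => ?_
    have h5 := hν k.le_succ
    have h6 := h3 k (mem_range.1 hk).le (ν k - ν (k + 1)) (by simpa using h5)
    have h7 := hΨ (ν k) (ν (k + 1)) (hε _) h5
    linarith
  have h5 := h3 t le_rfl (ν t - ε) (by linarith [hε t])
  have h6 := hΨ' (ν t) (hε t)
  have h7 : 0 ≤ ε * K (ν t) := mul_nonneg hε0 (hK _)
  rw [← sum_levels]
  linarith

/-! ### The Lyapunov function -/

/-- A continuous function that increases from `0` at `c` to `1` at `c + w`. -/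
noncomputable def ramp (c w y : ℝ) : ℝ := max 0 (min 1 ((y - c) / w))

/-- A discrete convex function whose slope increases from `0` to `1` between `c` and `c + w`. -/
noncomputable def rampSum (c w : ℝ) (n : ℕ) : ℝ := ∑ j ∈ range n, ramp c w j

theorem ramp_nonneg (c w y : ℝ) : 0 ≤ ramp c w y := le_max_left _ _

theorem ramp_le_one (c w y : ℝ) : ramp c w y ≤ 1 := max_le zero_le_one (min_le_left _ _)

theorem ramp_eq_one {c w y : ℝ} (hw : 0 < w) (h : c + w ≤ y) : ramp c w y = 1 := by
  refine le_antisymm (ramp_le_one _ _ _) (le_max_of_le_right (le_min le_rfl ?_))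
  rw [le_div_iff₀ hw]; linarith

theorem ramp_eq_zero {c w y : ℝ} (hw : 0 < w) (h : y ≤ c) : ramp c w y = 0 := by
  refine le_antisymm (max_le le_rfl (min_le_of_right_le ?_)) (ramp_nonneg _ _ _)
  exact div_nonpos_of_nonpos_of_nonneg (by linarith) hw.le

theorem ramp_le_add {c w : ℝ} (hw : 0 < w) (y : ℝ) : ramp c w y ≤ ramp c w (y - 1) + 1 / w := by
  have hw' : 0 ≤ 1 / w := by positivity
  have e : (y - c) / w = (y - 1 - c) / w + 1 / w := by ring
  refine max_le (by linarith [ramp_nonneg c w (y - 1)]) ?_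
  rw [e]
  calc min 1 ((y - 1 - c) / w + 1 / w) ≤ min 1 ((y - 1 - c) / w) + 1 / w := by
        rw [← min_add_add_right]
        exact min_le_min_right _ (by linarith)
    _ ≤ _ := add_le_add_left (le_max_right _ _) _

theorem rampSum_succ (c w : ℝ) (n : ℕ) : rampSum c w (n + 1) = rampSum c w n + ramp c w n :=
  sum_range_succ _ _

theorem rampSum_nonneg (c w : ℝ) (n : ℕ) : 0 ≤ rampSum c w n :=
  sum_nonneg fun _ _ => ramp_nonneg _ _ _

theorem sub_le_rampSum {c w : ℝ} (hc : 0 ≤ c) (hw : 0 < w) (n : ℕ) :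
    n - c - w - 1 ≤ rampSum c w n := by
  induction n with
  | zero => simp [rampSum]; linarith
  | succ n ih =>
    rw [rampSum_succ]
    push_cast
    by_cases h : c + w ≤ n
    · rw [ramp_eq_one hw h]; linarith
    · linarith [rampSum_nonneg c w n, ramp_nonneg c w n]

theorem rampSum_le {c w : ℝ} (hw : 0 < w) (n : ℕ) : rampSum c w n ≤ max 0 (n - c) := by
  induction n with
  | zero => simp [rampSum]
  | succ n ih =>
    rw [rampSum_succ]
    push_cast
    by_cases h : (n : ℝ) ≤ c
    · rw [ramp_eq_zero hw h, add_zero]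
      exact ih.trans (max_le_max le_rfl (by linarith))
    · rw [max_eq_right (by linarith)] at ih
      exact le_max_of_le_right (by linarith [ramp_le_one c w n])

/-- The Lyapunov function that controls the number of jobs. -/
noncomputable def lyapunov (c w : ℝ) (q : State N b) : ℝ :=
  waiting q + rampSum c w (busy univ q).toNat

theorem lyapunov_arrive_of_idle (hb : 0 < b) (c w : ℝ) {q : State N b} {m : Fin N}
    (hm : (q m : ℕ) = 0) :
    lyapunov c w (arrive q m) = lyapunov c w q + ramp c w (busy univ q).toNat := by
  have h1 := busy_arrive hb univ q m
  have h2 := waiting_arrive hb q m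
  have h3 := busy_nonneg univ q
  rw [if_pos ⟨mem_univ _, hm⟩] at h1
  rw [if_neg (by omega)] at h2
  unfold lyapunov
  rw [h1, h2, add_zero, show (busy univ q + 1).toNat = (busy univ q).toNat + 1 by omega,
    rampSum_succ]
  ring

/-- If all servers are busy the arrival can only add a waiting job, and `c + w ≤ N` makes the slope
there `1`. -/
theorem lyapunov_arrive (hb : 0 < b) {c w : ℝ} (hw : 0 < w) (hcw : c + w ≤ N) {q : State N b}
    {m : Fin N} (hm : m ∈ fastestShortest μ q) :
    lyapunov c w q ≤ lyapunov c w (arrive q m) ∧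
      lyapunov c w (arrive q m) ≤ lyapunov c w q + ramp c w (busy univ q).toNat := by
  by_cases hi : busy univ q < N
  · obtain ⟨l, hl⟩ := exists_idle_univ hi
    rw [lyapunov_arrive_of_idle hb c w (idle_of_mem_fastestShortest hl hm).1]
    exact ⟨by linarith [ramp_nonneg c w (busy univ q).toNat], le_rfl⟩
  · have h1 := busy_arrive hb univ q m
    have h2 := waiting_arrive hb q m
    have h3 := busy_univ_le q
    have h4 := busy_univ_le (arrive q m)
    have e : busy univ (arrive q m) = busy univ q := by split_ifs at h1 <;> omega
    have e2 : ((busy univ q).toNat : ℝ) = N := by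
      have : (busy univ q).toNat = N := by omega
      rw [this]
    rw [e2, ramp_eq_one hw hcw]
    unfold lyapunov
    rw [e, h2]
    push_cast
    split_ifs <;> constructor <;> linarith

theorem lyapunov_depart (c w : ℝ) (q : State N b) (m : Fin N) :
    lyapunov c w (depart q m) = lyapunov c w q -
      (ramp c w ((busy univ q).toNat - 1) * (if (q m : ℕ) = 1 then 1 else 0) +
        if 2 ≤ (q m : ℕ) then 1 else 0) := by
  have h1 := busy_depart univ q m
  have h2 := waiting_depart q m
  have h3 := busy_nonneg univ (depart q m)
  simp only [mem_univ, true_and] at h1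
  unfold lyapunov
  rw [h2]
  by_cases hm : (q m : ℕ) = 1
  · rw [if_pos hm] at h1
    obtain ⟨k, hk⟩ := Int.eq_ofNat_of_zero_le h3
    have h4 : busy univ q = ((k + 1 : ℕ) : ℤ) := by push_cast; omega
    rw [hk, h4, Int.toNat_natCast, Int.toNat_natCast, rampSum_succ]
    simp only [hm, Nat.cast_add, Nat.cast_one, add_sub_cancel_right, if_true]
    norm_num
    ring
  · rw [if_neg hm, sub_zero] at h1
    rw [h1]
    simp only [hm, if_false]
    push_cast
    ring

/-- An arrival uses the slope at the busy count, a departure from a one-job server the slope `s` one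
below; the mismatch costs `Λ / w`. The rest is the mixture, with weights `s` and `1 - s`, of the
drifts of all jobs and of waiting jobs. -/
theorem gen_lyapunov_le (hN : 0 < N) (hb : 0 < b) (hΛ : 0 ≤ Λ) (hμ : ∀ n, 0 ≤ μ n) {c w : ℝ}
    (hw : 0 < w) (hcw : c + w ≤ N) (q : State N b) :
    gen Λ μ (lyapunov c w) q ≤ Λ / w
      - ramp c w ((busy univ q).toNat - 1) * (serviceRate μ (1 ≤ ·) q - Λ)
      - (1 - ramp c w ((busy univ q).toNat - 1)) * serviceRate μ (2 ≤ ·) q := by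
  set s := ramp c w ((busy univ q).toNat - 1) with hs
  have h := gen_le (f := lyapunov c w) (q := q) hN hΛ hμ (a := ramp c w (busy univ q).toNat)
    (d := fun m => -(s * (if (q m : ℕ) = 1 then 1 else 0) + if 2 ≤ (q m : ℕ) then 1 else 0))
    (fun m hm => (lyapunov_arrive hb hw hcw hm).2)
    (fun m => by rw [lyapunov_depart]; exact le_of_eq (sub_eq_add_neg _ _))
  have h2 : ∑ n, μ n * -(s * (if (q n : ℕ) = 1 then 1 else 0) + if 2 ≤ (q n : ℕ) then 1 else 0) =
      -(s * serviceRate μ (· = 1) q) - serviceRate μ (2 ≤ ·) q := by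
    unfold serviceRate
    rw [mul_sum, ← sum_neg_distrib, ← sum_sub_distrib]
    exact sum_congr rfl fun n _ => by ring
  rw [h2] at h
  have h3 := mul_le_mul_of_nonneg_left (ramp_le_add (c := c) hw (busy univ q).toNat) hΛ
  rw [← hs] at h3
  have h4 := serviceRate_add μ q
  have h5 : serviceRate μ (· = 1) q = serviceRate μ (1 ≤ ·) q - serviceRate μ (2 ≤ ·) q := by
    linarith
  rw [h5] at h
  have h6 : Λ * (s + 1 / w) = Λ * s + Λ / w := by ring
  linarith

/-- Each part of the mixture supplies `2 * γ`: where `s > 0`, enough servers are busy for `hbad`;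
where `s < 1`, the ramp part is at most `w + 1`, so at least `w` jobs wait. -/
theorem prob_lyapunov_gt_le (hN : 0 < N) (hb : 2 ≤ b) (hΛ : 0 ≤ Λ) (hΛN : Λ ≤ N)
    (hπ : IsSteadyState Λ μ π) {ε : ℝ} (hε : 0 < ε) (hμ : ∀ n, ε ≤ μ n) {c w γ : ℝ}
    (hw : 0 < w) (hcw : c + w ≤ N) (hγ : 0 < γ)
    (hγw : 2 * γ * (b - 1) ≤ ε * w) (hwγ : Λ / w ≤ γ) (bad : State N b → Prop)
    (hbad : ∀ q, ¬ bad q → c + 1 ≤ busy univ q → Λ + 2 * γ ≤ serviceRate μ (1 ≤ ·) q) (n : ℕ) :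
    prob π (fun q => 2 * (w + 1) + 2 * n < lyapunov c w q) ≤
      Real.exp (-(n * (γ / (N + γ)))) + prob π bad * ((N + γ) / γ) := by
  have hμ0 : ∀ n, 0 ≤ μ n := fun n => hε.le.trans (hμ n)
  have hb1 : (0 : ℝ) < (b : ℝ) - 1 := by
    have : (2 : ℝ) ≤ b := by exact_mod_cast hb
    linarith
  refine prob_tail_real hN hΛ hμ0 hπ (lyapunov c w) bad (2 * (w + 1)) hΛN hγ ?_ ?_ ?_ n
  · intro q m hm
    have h := lyapunov_arrive (by omega : 0 < b) hw hcw hm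
    exact ⟨h.1, by linarith [ramp_le_one c w (busy univ q).toNat]⟩
  · intro q m
    have h0 := ramp_nonneg c w ((busy univ q).toNat - 1)
    have h1 := ramp_le_one c w ((busy univ q).toNat - 1)
    rw [lyapunov_depart]
    split_ifs with h2 h3 h3
    · omega
    all_goals constructor <;> linarith
  · intro q hq hnb
    have h := gen_lyapunov_le hN (by omega : 0 < b) hΛ hμ0 hw hcw q
    have hB : (((busy univ q).toNat : ℕ) : ℝ) = busy univ q := by
      have := Int.toNat_of_nonneg (busy_nonneg univ q)
      exact_mod_cast this
    set s := ramp c w ((busy univ q).toNat - 1) with hs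
    have hs0 : 0 ≤ s := ramp_nonneg _ _ _
    have hs1 : s ≤ 1 := ramp_le_one _ _ _
    have h1 : s * (2 * γ) ≤ s * (serviceRate μ (1 ≤ ·) q - Λ) := by
      by_cases hc : c + 1 ≤ busy univ q
      · exact mul_le_mul_of_nonneg_left (by linarith [hbad q hnb hc]) hs0
      · rw [hs, ramp_eq_zero hw (by linarith), zero_mul, zero_mul]
    have h2 : (1 - s) * (2 * γ) ≤ (1 - s) * serviceRate μ (2 ≤ ·) q := by
      by_cases hc : c + w ≤ (busy univ q).toNat - 1
      · rw [hs, ramp_eq_one hw hc, sub_self, zero_mul, zero_mul]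
      · refine mul_le_mul_of_nonneg_left ?_ (by linarith)
        have h3 := rampSum_le (c := c) hw (busy univ q).toNat
        have h4 : rampSum c w (busy univ q).toNat ≤ w + 1 :=
          h3.trans (max_le (by linarith) (by linarith))
        have h5 : w ≤ waiting q := by unfold lyapunov at hq; linarith
        have h6 := mul_waiting_le hε.le hμ q
        have h7 := mul_le_mul_of_nonneg_left h5 hε.le
        exact le_of_mul_le_mul_left (by linarith) hb1
    linarith

/-! ### Tolerated deficits and their cost -/

/-- The rates `μ`, continued to all natural numbers by the smallest rate. -/
def extend (hN : 0 < N) (μ : Fin N → ℝ) (k : ℕ) : ℝ := μ ⟨min k (N - 1), by omega⟩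

theorem extend_val (hN : 0 < N) (μ : Fin N → ℝ) (i : Fin N) : extend hN μ i = μ i := by
  unfold extend
  congr 1
  ext
  simp only
  omega

theorem extend_antitone (hN : 0 < N) (hμ : Antitone μ) : Antitone (extend hN μ) := fun k l h =>
  hμ (by rw [Fin.le_def]; simp only; omega)

theorem sum_range_extend (hN : 0 < N) (μ : Fin N → ℝ) (i : Fin N) :
    ∑ k ∈ range ((i : ℕ) + 1), extend hN μ k = ∑ n ∈ Iic i, μ n := by
  symm
  refine sum_nbij (fun n => (n : ℕ)) ?_ ?_ ?_ ?_
  · intro n hn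
    rw [mem_Iic, Fin.le_def] at hn
    rw [mem_range]; omega
  · intro n _ m _ h
    exact Fin.ext h
  · intro k hk
    rw [mem_coe, mem_range] at hk
    exact ⟨⟨k, by omega⟩, by rw [mem_coe, mem_Iic, Fin.le_def]; simp only; omega, rfl⟩
  · intro n _
    exact (extend_val hN μ n).symm

theorem sum_Iic_add (i : Fin N) : ∑ n ∈ Iic i, μ n + ∑ n ∈ Ioi i, μ n = ∑ n, μ n := by
  rw [← sum_union]
  · congr 1
    ext n
    simp [le_or_gt]
  · rw [disjoint_left]
    intro n h1 h2
    rw [mem_Iic] at h1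
    rw [mem_Ioi] at h2
    exact absurd h2 (not_lt.2 h1)

theorem card_Ioi_cast (i : Fin N) : ((Ioi i).card : ℝ) = N - ((i : ℕ) + 1) := by
  rw [Fin.card_Ioi, Nat.sub_sub, Nat.cast_sub (by omega)]
  push_cast; ring

/-- The slow servers are at least as many as their total rate. -/
theorem sum_Ioi_le (hμ : Antitone μ) (hsum : ∑ n, μ n = N) (i : Fin N) :
    ∑ n ∈ Ioi i, μ n ≤ N - ((i : ℕ) + 1) := by
  by_cases h : 1 ≤ μ i
  · have h1 : ((Iic i).card : ℝ) * 1 ≤ ∑ n ∈ Iic i, μ n := by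
      rw [← nsmul_eq_mul]
      exact card_nsmul_le_sum _ _ _ fun n hn => h.trans (hμ (mem_Iic.1 hn))
    rw [Fin.card_Iic] at h1
    push_cast at h1
    have := sum_Iic_add (μ := μ) i
    linarith
  · rw [← card_Ioi_cast, ← mul_one ((Ioi i).card : ℝ), ← nsmul_eq_mul]
    exact sum_le_card_nsmul _ _ _ fun n hn => (hμ (mem_Ioi.1 hn).le).trans (not_le.1 h).le

/-- Beyond half the tolerance `K = κ / √(μ i)` the restoring drift is at least `γ = μ i * K / 2`.
The other half gives exponent about `K * γ / (2 * N) = 2 * R * ℓ`, with room for rounding. -/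
theorem prob_deficit_gt_sqrt (hN : 0 < N) (hb : 0 < b) (hμ0 : ∀ n, 0 < μ n) (hμ : Antitone μ)
    (hsum : ∑ n, μ n = N) (hΛ : 0 ≤ Λ) (hπ : IsSteadyState Λ μ π) {R ℓ κ : ℝ} (i : Fin N)
    (hcap : ∑ n ∈ Iic i, μ n ≤ Λ) (hR : 2 ≤ R) (hℓ : 1 ≤ ℓ) (hκ : 0 < κ)
    (hκ2 : κ ^ 2 = 8 * N * R * ℓ) (hi : 3200 * (R * ℓ) * μ i ≤ N) :
    prob π (fun q => κ / √(μ i) <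
      ((i : ℕ) : ℝ) + 1 - busy (univ.filter (fun n => μ i ≤ μ n)) q) ≤
      Real.exp (-((R + 1 / 2) * ℓ)) := by
  have hv := hμ0 i
  have hs : 0 < √(μ i) := Real.sqrt_pos.2 hv
  have hs2 : √(μ i) ^ 2 = μ i := Real.sq_sqrt hv.le
  have hNR : (0 : ℝ) < N := by exact_mod_cast hN
  set s := √(μ i)
  set K := κ / s with hK
  have hK0 : 0 < K := by positivity
  have hKs : K * s = κ := by rw [hK]; field_simp
  set γ := κ * s / 2 with hγdef
  have hγ : 0 < γ := by positivity
  have hγK : γ = μ i * (K / 2) := by rw [hγdef, ← hKs, ← hs2]; ring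
  have hγN : γ ≤ N / 20 := by
    have h1 : γ ^ 2 = 2 * N * (R * ℓ * μ i) := by
      rw [hγdef, div_pow, mul_pow, hκ2, hs2]; ring
    have h2 : γ ^ 2 ≤ (N / 20) ^ 2 := by rw [h1]; nlinarith
    exact (sq_le_sq₀ hγ.le (by positivity)).1 h2
  have hfl : K / 2 < (⌊K / 2⌋₊ : ℝ) + 1 := Nat.lt_floor_add_one _
  have hfl' : (⌊K / 2⌋₊ : ℝ) ≤ K / 2 := Nat.floor_le (by positivity)
  refine le_trans (prob_mono hπ.1 ?_) ((prob_deficit_le hN hb (fun n => (hμ0 n).le) hμ hsum hΛ hπ i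
    ⌊K / 2⌋₊ hγ ?_ ⌊K / 2⌋₊).trans ?_)
  · intro q hq
    have : ((⌊K / 2⌋₊ : ℤ) + ⌊K / 2⌋₊ : ℝ) ≤
      ((i : ℕ) : ℝ) + 1 - busy (univ.filter (fun n => μ i ≤ μ n)) q := by
      push_cast
      linarith
    exact_mod_cast this
  · have := mul_le_mul_of_nonneg_left hfl.le hv.le
    rw [hγK]
    linarith
  · rw [Real.exp_le_exp, neg_le_neg_iff, mul_div_assoc', le_div_iff₀ (by linarith)]
    have h1 : (K / 2 - 1) * γ ≤ ⌊K / 2⌋₊ * γ := mul_le_mul_of_nonneg_right (by linarith) hγ.le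
    have h2 : K / 2 * γ = 2 * N * R * ℓ := by
      have : K / 2 * γ = (K * s) * κ / 4 := by rw [hγdef]; ring
      rw [this, hKs]
      linarith
    have h3 : (R + 1 / 2) * ℓ * (N + γ) ≤ (5 / 4 * R) * ℓ * (N + N / 20) := by
      gcongr
      linarith
    have h4 : 1 * N ≤ R * ℓ * N := mul_le_mul_of_nonneg_right (by nlinarith) hNR.le
    nlinarith

/-- Servers of rate at least `4` number at most `N / 4`; the others keep capacity at least `3 * ε *
N / 4`. With `x ≤ ε * N / 2` the arrivals exceed the capacity of `Iic i` by `ε * N / 4`, whatever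
the deficit. -/
theorem prob_deficit_gt_of_fast (hN : 0 < N) (hb : 0 < b) (hμ : Antitone μ) {ε : ℝ} (hε : 0 < ε)
    (hμε : ∀ n, ε ≤ μ n) (hε2 : ε ≤ 1 / 2)
    (hsum : ∑ n, μ n = N) (hΛ : 0 ≤ Λ) (hπ : IsSteadyState Λ μ π) {R ℓ x : ℝ} (i : Fin N)
    (hx : Λ = N - x) (hxε : x ≤ ε * N / 2) (hR : 2 ≤ R) (hℓ : 1 ≤ ℓ) (hi : 4 ≤ μ i) :
    prob π (fun q => 7 * R * ℓ / ε <
      ((i : ℕ) : ℝ) + 1 - busy (univ.filter (fun n => μ i ≤ μ n)) q) ≤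
      Real.exp (-((R + 1 / 2) * ℓ)) := by
  have hNR : (0 : ℝ) < N := by exact_mod_cast hN
  have hγ : 0 < ε * N / 4 := by positivity
  have hK : 0 < 7 * R * ℓ / ε := by positivity
  set K := 7 * R * ℓ / ε with hKdef
  have hfl : K < (⌊K⌋₊ : ℝ) + 1 := Nat.lt_floor_add_one _
  have hfl' : (⌊K⌋₊ : ℝ) ≤ K := Nat.floor_le hK.le
  refine le_trans (prob_mono hπ.1 ?_) ((prob_deficit_le hN hb (fun n => hε.le.trans (hμε n)) hμ
    hsum hΛ hπ i 0 hγ ?_ ⌊K⌋₊).trans ?_)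
  · intro q hq
    have : (⌊K⌋₊ : ℝ) ≤
      ((i : ℕ) : ℝ) + 1 - busy (univ.filter (fun n => μ i ≤ μ n)) q := by
      linarith
    rw [Nat.cast_zero, zero_add]
    exact_mod_cast this
  · have h1 : ((Iic i).card : ℝ) * 4 ≤ ∑ n ∈ Iic i, μ n := by
      rw [← nsmul_eq_mul]
      exact card_nsmul_le_sum _ _ _ fun n hn => hi.trans (hμ (mem_Iic.1 hn))
    have h2 : ((Ioi i).card : ℝ) * ε ≤ ∑ n ∈ Ioi i, μ n := by
      rw [← nsmul_eq_mul]
      exact card_nsmul_le_sum _ _ _ fun n _ => hμε n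
    have h3 := sum_Iic_add (μ := μ) i
    rw [card_Ioi_cast] at h2
    rw [Fin.card_Iic] at h1
    push_cast at h1 ⊢
    have h4 : (((i : ℕ) : ℝ) + 1) * 4 ≤ N := by
      have : 0 ≤ ((N : ℝ) - ((i : ℕ) + 1)) * ε := by
        rw [← card_Ioi_cast]; positivity
      linarith
    nlinarith
  · rw [Real.exp_le_exp, neg_le_neg_iff, mul_div_assoc', le_div_iff₀ (by linarith)]
    have h1 : (K - 1) * (ε * N / 4) ≤ ⌊K⌋₊ * (ε * N / 4) :=
      mul_le_mul_of_nonneg_right (by linarith) hγ.le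
    have h2 : K * (ε * N / 4) = 7 / 4 * (R * ℓ * N) := by rw [hKdef]; field_simp
    have h3 : (R + 1 / 2) * ℓ * (N + ε * N / 4) ≤ (5 / 4 * R) * ℓ * (N + N / 8) := by
      have h6 : ε * N / 4 ≤ N / 8 := by nlinarith
      exact mul_le_mul (mul_le_mul_of_nonneg_right (by linarith) (by linarith)) (by linarith)
        (by positivity) (by positivity)
    have h4 : 2 * N ≤ R * ℓ * N := mul_le_mul_of_nonneg_right (by nlinarith) hNR.le
    have h5 : ε * N ≤ N / 2 := by nlinarith
    linarith

/-- The tolerated deficit of busy servers among those with rate at least `y`. -/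
noncomputable def deficit (M κ κ' y : ℝ) : ℝ := if y ≤ M then κ / √y else κ'

/-- A bound for the total service rate lost to the deficits tolerated by `deficit`. -/
noncomputable def deficitRate (M κ κ' y : ℝ) : ℝ := κ' * y + 2 * κ * √(min y M)

theorem deficit_nonneg {M κ κ' : ℝ} (hκ : 0 ≤ κ) (hκ' : 0 ≤ κ') (y : ℝ) :
    0 ≤ deficit M κ κ' y := by
  unfold deficit; split_ifs <;> positivity

/-- For `y ≤ M` this is the concavity of the square root, `(y - z) / √y ≤ 2 * (√y - √z)`; above `M`
the term `κ' * y` suffices. -/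
theorem sub_mul_deficit_le {M κ κ' : ℝ} (hκ : 0 ≤ κ) (hκ' : 0 ≤ κ') {y z : ℝ} (hz : 0 < z)
    (hzy : z ≤ y) :
    (y - z) * deficit M κ κ' y ≤ deficitRate M κ κ' y - deficitRate M κ κ' z := by
  unfold deficit deficitRate
  split_ifs with h
  · rw [min_eq_left h, min_eq_left (hzy.trans h)]
    have hy : 0 < y := hz.trans_le hzy
    have h1 : √z ≤ √y := Real.sqrt_le_sqrt hzy
    have h2 : 0 < √y := Real.sqrt_pos.2 hy
    have h3 : (y - z) * (κ / √y) ≤ 2 * κ * (√y - √z) := by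
      rw [mul_div_assoc', div_le_iff₀ h2]
      have e : y - z = (√y - √z) * (√y + √z) := by
        nlinarith [Real.mul_self_sqrt hy.le, Real.mul_self_sqrt hz.le]
      rw [e]
      have h4 : (√y - √z) * (√y + √z) ≤ (√y - √z) * (2 * √y) :=
        mul_le_mul_of_nonneg_left (by linarith) (by linarith)
      have h5 := mul_le_mul_of_nonneg_right h4 hκ
      linarith
    have h4 : 0 ≤ κ' * (y - z) := mul_nonneg hκ' (by linarith)
    linarith
  · have h1 : √(min z M) ≤ √(min y M) := Real.sqrt_le_sqrt (min_le_min_right _ hzy)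
    have h2 := mul_le_mul_of_nonneg_left h1 (by positivity : 0 ≤ 2 * κ)
    linarith

theorem mul_deficit_le {M κ κ' : ℝ} (hκ : 0 ≤ κ) (hκ' : 0 ≤ κ') {y : ℝ} (hy : 0 < y) :
    y * deficit M κ κ' y ≤ deficitRate M κ κ' y := by
  unfold deficit deficitRate
  split_ifs with h
  · rw [min_eq_left h]
    have h2 : 0 < √y := Real.sqrt_pos.2 hy
    have e : y * (κ / √y) = κ * √y := by
      rw [mul_div_assoc', div_eq_iff h2.ne']
      nlinarith [Real.mul_self_sqrt hy.le]
    rw [e]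
    have : 0 ≤ κ' * y := by positivity
    have : 0 ≤ κ * √y := by positivity
    linarith
  · have : 0 ≤ 2 * κ * √(min y M) := by positivity
    linarith

/-- The parameters for which the number of idle fast servers is negligible. -/
theorem exists_deficit_parameters {N R ℓ ε x g μ₁ : ℝ} (hR : 2 ≤ R) (hε : 0 < ε)
    (hε2 : ε ≤ 1 / 2) (hεℓ : 2 * R ≤ ε * ℓ) (hg : 0 < g) (hgN : g ^ 2 = N)
    (hx : 2916 * R ^ 2 * ℓ ^ 2 * g ≤ ε ^ 2 * x) (hμ₁ : 256 * ℓ ^ 2 * μ₁ ≤ ε ^ 2 * x)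
    (hμ0 : 0 < μ₁) :
    ∃ M κ', 0 ≤ κ' ∧ (M = μ₁ ∨ (M = 4 ∧ κ' = 7 * R * ℓ / ε ∧ x ≤ ε * N / 2)) ∧
      deficitRate M (√(8 * N * R * ℓ)) κ' μ₁ ≤ 3 / 8 * (ε * x) := by
  have hℓ : 4 * R ≤ ℓ := by nlinarith
  have hℓ8 : 8 ≤ ℓ := by linarith
  have hN : 0 < N := by rw [← hgN]; positivity
  have hx0 : 0 < x := by
    have h1 : 0 < 2916 * R ^ 2 * ℓ ^ 2 * g := by positivity
    have h2 : 0 < ε ^ 2 * x := h1.trans_le hx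
    exact pos_of_mul_pos_right h2 (by positivity)
  have hRℓ : 0 < R * ℓ := by positivity
  set κ := √(8 * N * R * ℓ) with hκ
  have hκ2 : κ ^ 2 = 8 * N * R * ℓ := Real.sq_sqrt (by positivity)
  have hκ0 : 0 ≤ κ := Real.sqrt_nonneg _
  -- In the first case the loss splits as `4 * κ ≤ ε * x / 4` and `κ' * μ₁ ≤ ε * x / 8`. In the
  -- second, `N < 2 * x / ε` makes the square-root tolerance affordable for all rates.
  by_cases hc : x ≤ ε * N / 2
  · refine ⟨4, 7 * R * ℓ / ε, by positivity, Or.inr ⟨rfl, rfl, hc⟩, ?_⟩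
    unfold deficitRate
    have h1 : √(min μ₁ 4) ≤ 2 := by
      rw [Real.sqrt_le_left (by norm_num)]
      exact (min_le_right _ _).trans (by norm_num)
    have h2 : 2 * κ * √(min μ₁ 4) ≤ 4 * κ := by nlinarith
    have h3 : 4 * κ ≤ ε * x / 4 := by
      have h4 : (4 * κ) ^ 2 ≤ (ε * x / 4) ^ 2 := by
        have h5 : R * ℓ * g ≤ ε * x / 100 := by
          have h6 : ε ^ 2 * x ≤ ε * x := by
            have : 0 < ε * x := by positivity
            nlinarith
          have h7 : R * ℓ * g * 1 ≤ R * ℓ * g * (R * ℓ) :=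
            mul_le_mul_of_nonneg_left (by nlinarith) (by positivity)
          nlinarith
        have h8 : (R * ℓ * g) ^ 2 ≤ (ε * x / 100) ^ 2 := pow_le_pow_left₀ (by positivity) h5 2
        have h9 : N * (R * ℓ) * 1 ≤ N * (R * ℓ) * (R * ℓ) :=
          mul_le_mul_of_nonneg_left (by nlinarith) (by positivity)
        have h10 : (R * ℓ * g) ^ 2 = N * (R * ℓ) * (R * ℓ) := by rw [← hgN]; ring
        nlinarith
      exact (sq_le_sq₀ (by positivity) (by positivity)).1 h4
    have h5 : 7 * R * ℓ / ε * μ₁ ≤ ε * x / 8 := by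
      rw [div_mul_eq_mul_div, div_le_iff₀ hε]
      have h6 : R * ℓ * μ₁ ≤ ℓ ^ 2 * μ₁ / 4 := by
        have := mul_le_mul_of_nonneg_right hℓ (by positivity : 0 ≤ ℓ * μ₁)
        nlinarith
      nlinarith
    linarith
  · refine ⟨μ₁, 0, le_rfl, Or.inl rfl, ?_⟩
    unfold deficitRate
    rw [min_self, zero_mul, zero_add]
    have hs2 : √μ₁ ^ 2 = μ₁ := Real.sq_sqrt hμ0.le
    have h4 : (2 * κ * √μ₁) ^ 2 ≤ (3 / 8 * (ε * x)) ^ 2 := by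
      have e : (2 * κ * √μ₁) ^ 2 = 32 * N * (R * ℓ * μ₁) := by
        rw [mul_pow, mul_pow, hκ2, hs2]; ring
      rw [e]
      have h6 : R * ℓ * μ₁ * 2 ≤ ε * (ℓ ^ 2 * μ₁) := by
        have := mul_le_mul_of_nonneg_right hεℓ (by positivity : 0 ≤ ℓ * μ₁)
        nlinarith
      have h7 : ε * (ℓ ^ 2 * μ₁) ≤ ε * (ε ^ 2 * x / 256) :=
        mul_le_mul_of_nonneg_left (by linarith) hε.le
      have h8 : R * ℓ * μ₁ ≤ ε * (ε ^ 2 * x) / 512 := by linarith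
      have h9 : 32 * N * (R * ℓ * μ₁) ≤ 32 * N * (ε * (ε ^ 2 * x) / 512) :=
        mul_le_mul_of_nonneg_left h8 (by positivity)
      have h10 : ε * N * (ε ^ 2 * x) ≤ 2 * x * (ε ^ 2 * x) :=
        mul_le_mul_of_nonneg_right (by linarith) (by positivity)
      have h11 : 0 < (ε * x) ^ 2 := by positivity
      nlinarith
    exact (sq_le_sq₀ (by positivity) (by positivity)).1 h4

/-- The event that some level set of fast servers has many idle servers. -/
def LargeDeficit (ν : ℕ → ℝ) (μ : Fin N → ℝ) (K : ℝ → ℝ) (t : ℕ) (q : State N b) : Prop :=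
  ∃ k ∈ range (t + 1), K (ν k) < (k : ℝ) + 1 - busy (univ.filter (fun n => ν k ≤ μ n)) q

theorem prob_largeDeficit_le (hN : 0 < N) (hb : 0 < b) (hμ : Antitone μ) {ε : ℝ} (hε : 0 < ε)
    (hμε : ∀ n, ε ≤ μ n) (hε2 : ε ≤ 1 / 2) (hsum : ∑ n, μ n = N) {R ℓ x μ₁ M κ' : ℝ}
    (hΛ : 0 ≤ (N : ℝ) - x) (hπ : IsSteadyState ((N : ℝ) - x) μ π) (t : Fin N)
    (ht : ∑ n ∈ Iic t, μ n ≤ N - x) (hR : 2 ≤ R) (hℓ : 1 ≤ ℓ) (hμ₁ : ∀ n, μ n ≤ μ₁)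
    (hμ₁N : 3200 * (R * ℓ) * μ₁ ≤ N)
    (hM : M = μ₁ ∨ (M = 4 ∧ κ' = 7 * R * ℓ / ε ∧ x ≤ ε * N / 2)) :
    prob π (LargeDeficit (extend hN μ) μ (deficit M (√(8 * N * R * ℓ)) κ') t) ≤
      N * Real.exp (-((R + 1 / 2) * ℓ)) := by
  have hNR : (0 : ℝ) < N := by exact_mod_cast hN
  refine (prob_exists_le hπ.1 _ _).trans ?_
  have hk : ∀ k ∈ range ((t : ℕ) + 1), prob π (fun q =>
      deficit M (√(8 * N * R * ℓ)) κ' (extend hN μ k) <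
        (k : ℝ) + 1 - busy (univ.filter (fun n => extend hN μ k ≤ μ n)) q) ≤
      Real.exp (-((R + 1 / 2) * ℓ)) := by
    intro k hk
    have hkN : k < N := by have := mem_range.1 hk; omega
    obtain ⟨i, rfl⟩ : ∃ i : Fin N, k = i := ⟨⟨k, hkN⟩, rfl⟩
    rw [extend_val]
    unfold deficit
    by_cases hi : μ i ≤ M
    · rw [if_pos hi]
      refine prob_deficit_gt_sqrt hN hb (fun n => hε.trans_le (hμε n)) hμ hsum hΛ hπ i ?_ hR hℓ
        (Real.sqrt_pos.2 (by positivity)) (Real.sq_sqrt (by positivity)) ?_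
      · refine le_trans (sum_le_sum_of_subset_of_nonneg (Iic_subset_Iic.2 ?_) ?_) ht
        · rw [Fin.le_def]; have := mem_range.1 hk; omega
        · intro n _ _; exact hε.le.trans (hμε n)
      · refine le_trans ?_ hμ₁N
        exact mul_le_mul_of_nonneg_left (hμ₁ i) (by positivity)
    · rw [if_neg hi]
      rcases hM with rfl | ⟨rfl, rfl, hx⟩
      · exact absurd (hμ₁ i) hi
      · exact prob_deficit_gt_of_fast hN hb hμ hε hμε hε2 hsum hΛ hπ i rfl hx hR hℓ
          (not_le.1 hi).le
  refine (sum_le_card_nsmul _ _ _ hk).trans ?_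
  rw [card_range, nsmul_eq_mul]
  refine mul_le_mul_of_nonneg_right ?_ (Real.exp_pos _).le
  exact_mod_cast t.2

/-- The `x / 2` extra busy servers contribute `ε * x / 2`, of which the deficits take at most `3 * ε
* x / 8`. -/
theorem le_serviceRate_of_not_largeDeficit (hN : 0 < N) (hμ : Antitone μ) {ε : ℝ} (hε : 0 < ε)
    (hμε : ∀ n, ε ≤ μ n) {x μ₁ M κ κ' : ℝ} (hκ : 0 ≤ κ) (hκ' : 0 ≤ κ') (t : Fin N)
    (ht : ∑ n ∈ Iic t, μ n = N - x) (hμ₁ : μ ⟨0, hN⟩ = μ₁)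
    (hΨ : deficitRate M κ κ' μ₁ ≤ 3 / 8 * (ε * x)) {q : State N b}
    (hq : ¬ LargeDeficit (extend hN μ) μ (deficit M κ κ') t q)
    (hB : (t : ℕ) + 1 + x / 2 ≤ busy univ q) :
    N - x + ε * x / 8 ≤ serviceRate μ (1 ≤ ·) q := by
  have h := le_serviceRate (q := q) (t := t) (extend_antitone hN hμ) (fun k => hμε _) hμε
    (K := deficit M κ κ') (Ψ := deficitRate M κ κ') hε.le (deficit_nonneg hκ hκ')
    (fun y z hz hzy => sub_mul_deficit_le hκ hκ' (hε.trans_le hz) hzy)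
    (fun y hy => mul_deficit_le hκ hκ' (hε.trans_le hy)) (fun k hk => by
      by_contra! hc
      exact hq ⟨k, mem_range.2 (by omega), hc⟩)
  have h0 : extend hN μ 0 = μ₁ := by rw [← hμ₁]; exact extend_val hN μ ⟨0, hN⟩
  rw [sum_range_extend, ht, h0] at h
  have h1 : ε * (x / 2) ≤ ε * (busy univ q - ((t : ℕ) + 1)) :=
    mul_le_mul_of_nonneg_left (by linarith) hε.le
  linarith

/-! ### The moment bound for large spare capacity -/

theorem large_capacity_bounds {N b R ℓ ε x g : ℝ} (hR : 2 ≤ R) (hε : 0 < ε)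
    (hε2 : ε ≤ 1 / 2) (hℓ : 8 ≤ ℓ) (hg : 1 ≤ g) (hgN : g ^ 2 = N) (hb : 2 ≤ b) (hx0 : 0 < x)
    (hx : 729 * R ^ 2 * b ^ 2 * ℓ ^ 2 * g ≤ ε ^ 2 * x) :
    96 ≤ x ∧ 128 * (b * g) ≤ ε * x ∧ N * (b * (4096 * (R * ℓ))) ≤ ε * x * x := by
  have hεx0 : 0 < ε * x := by positivity
  have hεx1 : ε * x ≤ x := by nlinarith
  have hεεx : ε ^ 2 * x ≤ ε * x / 2 := by nlinarith
  have h16 : 16 ≤ R * ℓ := by nlinarith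
  have hb0 : 0 < b := by linarith
  have hg0 : 0 < g := by linarith
  have hkey : 23328 * (R * ℓ * (b ^ 2 * g)) ≤ ε * x := by
    have := mul_le_mul_of_nonneg_left h16 (by positivity : 0 ≤ 1458 * (R * ℓ * (b ^ 2 * g)))
    have e : 1458 * (R * ℓ * (b ^ 2 * g)) * (R * ℓ) = 2 * (729 * R ^ 2 * b ^ 2 * ℓ ^ 2 * g) := by
      ring
    linarith
  have hb2g : 128 * (b * g) ≤ ε * x := by
    have h1 : 16 * 1 ≤ R * ℓ * b := mul_le_mul h16 (by linarith) zero_le_one (by linarith)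
    have := mul_le_mul_of_nonneg_left h1 (by positivity : 0 ≤ b * g)
    have e : b * g * (R * ℓ * b) = R * ℓ * (b ^ 2 * g) := by ring
    linarith
  have hbg : 1 ≤ b * g := by nlinarith
  refine ⟨by linarith, hb2g, ?_⟩
  have h1 := mul_le_mul hkey hkey (by positivity) hεx0.le
  have h2 : (ε * x) * (ε * x) ≤ ε * x * x := mul_le_mul_of_nonneg_left hεx1 hεx0.le
  have h3 : 16 * 1 ≤ R * ℓ * b ^ 3 :=
    mul_le_mul h16 (one_le_pow₀ (by linarith)) zero_le_one (by linarith)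
  have h4 : 0 ≤ N * (b * (R * ℓ)) := by rw [← hgN]; positivity
  have h5 := mul_le_mul_of_nonneg_left h3 h4
  have e : 23328 * (R * ℓ * (b ^ 2 * g)) * (23328 * (R * ℓ * (b ^ 2 * g))) =
      23328 ^ 2 * (N * (b * (R * ℓ)) * (R * ℓ * b ^ 3)) := by rw [← hgN]; ring
  rw [e] at h1
  linarith

set_option maxHeartbeats 1000000 in
/-- The probability of a large number of jobs, when the spare capacity `x` is large. -/
theorem prob_total_gt_le (hN : 2 ≤ N) (hb : 2 ≤ b) (hμ : Antitone μ) {ε : ℝ} (hε : 0 < ε)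
    (hμε : ∀ n, ε ≤ μ n) (hε2 : ε ≤ 1 / 2) (hsum : ∑ n, μ n = N) {r : ℕ} {x ℓ g : ℝ} (hr : 0 < r)
    (hΛ : 0 ≤ (N : ℝ) - x) (hπ : IsSteadyState ((N : ℝ) - x) μ π) (t : Fin N)
    (ht : ∑ n ∈ Iic t, μ n = N - x) (hℓ : ℓ = Real.log N) (hg : g = √N)
    (hεℓ : 2 * ((r : ℝ) + 1) ≤ ε * ℓ)
    (hx : 729 * ((r : ℝ) + 1) ^ 2 * b ^ 2 * ℓ ^ 2 * g ≤ ε ^ 2 * x)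
    (hμ₁ : 256 * ℓ ^ 2 * μ ⟨0, by omega⟩ ≤ ε ^ 2 * x) :
    prob π (fun q => (t : ℕ) + 1 + 3 / 4 * x < total q) ≤ 2 / (N : ℝ) ^ r := by
  have hN0 : 0 < N := by omega
  have hNR : (0 : ℝ) < N := by exact_mod_cast hN0
  have hN1 : (1 : ℝ) ≤ N := by exact_mod_cast hN0
  have hrR : (1 : ℝ) ≤ r := by exact_mod_cast hr
  have hbR : (2 : ℝ) ≤ b := by exact_mod_cast hb
  set μ₁ := μ ⟨0, hN0⟩ with hμ₁def
  set R : ℝ := (r : ℝ) + 1 with hRdef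
  have hR : 2 ≤ R := by linarith
  have hℓ4 : 4 * R ≤ ℓ := by nlinarith
  have hℓ8 : 8 ≤ ℓ := by linarith
  have hg1 : 1 ≤ g := by rw [hg]; exact Real.one_le_sqrt.2 hN1
  have hgN : g ^ 2 = N := by rw [hg]; exact Real.sq_sqrt hNR.le
  have hμ10 : 0 < μ₁ := hε.trans_le (hμε _)
  have hμ1le : ∀ n, μ n ≤ μ₁ := fun n => hμ (by rw [Fin.le_def]; exact Nat.zero_le _)
  have hx' : 2916 * R ^ 2 * ℓ ^ 2 * g ≤ ε ^ 2 * x := by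
    refine le_trans ?_ hx
    have h1 : (4 : ℝ) ≤ (b : ℝ) ^ 2 := by nlinarith
    have := mul_le_mul_of_nonneg_left h1 (by positivity : 0 ≤ 729 * R ^ 2 * ℓ ^ 2 * g)
    linarith
  have hx0 : 0 < x := by
    have h1 : 0 < 2916 * R ^ 2 * ℓ ^ 2 * g := by positivity
    exact pos_of_mul_pos_right (h1.trans_le hx') (by positivity)
  have hεx0 : 0 < ε * x := by positivity
  obtain ⟨hx96, hb2g, hx2⟩ := large_capacity_bounds hR hε hε2 hℓ8 hg1 hgN hbR hx0 hx
  have hxN : x ≤ N := by linarith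
  obtain ⟨M, κ', hκ', hM, hΨ⟩ := exists_deficit_parameters hR hε hε2 hεℓ (by linarith) hgN hx'
    hμ₁ hμ10
  set κ := √(8 * N * R * ℓ) with hκ
  have hμ₁N : 3200 * (R * ℓ) * μ₁ ≤ N := by
    have h1 : R * ℓ * μ₁ ≤ ℓ ^ 2 * μ₁ / 4 := by
      have := mul_le_mul_of_nonneg_right hℓ4 (by positivity : 0 ≤ ℓ * μ₁)
      nlinarith
    have h2 : ε ^ 2 * x ≤ x / 4 := by nlinarith
    linarith
  set bad : State N b → Prop := LargeDeficit (extend hN0 μ) μ (deficit M κ κ') t with hbad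
  have hpbad : prob π bad ≤ N * Real.exp (-((R + 1 / 2) * ℓ)) :=
    prob_largeDeficit_le hN0 (by omega) hμ hε hμε hε2 hsum hΛ hπ t ht.le hR (by linarith) hμ1le
      hμ₁N hM
  -- Makes `2 * γ * b = ε * w` for the ramp width `w = x / 32`.
  set γ : ℝ := ε * x / (64 * b) with hγdef
  have hγ : 0 < γ := by positivity
  have hγb : γ * (64 * b) = ε * x := by rw [hγdef]; field_simp
  have hγN : γ ≤ N := by nlinarith
  -- The slow servers have total rate `x`, so there are at least `x` of them and the ramp ends
  -- before `N`.
  have hNt : x ≤ N - ((t : ℕ) + 1) := by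
    have h1 := sum_Ioi_le hμ hsum t
    have h2 := sum_Iic_add (μ := μ) t
    linarith
  have hwγ : ((N : ℝ) - x) / (x / 32) ≤ γ := by
    rw [div_le_iff₀ (by linarith), hγdef]
    have h1 : 1 ≤ R * ℓ := by nlinarith
    have h2 := mul_le_mul_of_nonneg_left h1 (by positivity : 0 ≤ (N : ℝ) * (b * 4096))
    rw [div_mul_div_comm, le_div_iff₀ (by positivity)]
    have h3 : 0 ≤ x * (b : ℝ) := by positivity
    nlinarith
  have hlyap := prob_lyapunov_gt_le hN0 hb hΛ (by linarith) hπ hε hμε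
    (c := (t : ℕ) + 1 + x / 2) (w := x / 32) (γ := γ) (by linarith) (by linarith) hγ
    (by
      have h1 : 2 * γ * (b - 1) ≤ 2 * γ * b := mul_le_mul_of_nonneg_left (by linarith) (by positivity)
      linarith) hwγ bad
    (fun q hq hB => by
      have h1 := le_serviceRate_of_not_largeDeficit hN0 hμ hε hμε (Real.sqrt_nonneg _) hκ' t ht rfl
        hΨ hq (by linarith)
      have h2 : 2 * γ ≤ ε * x / 8 := by
        rw [← hγb]
        nlinarith
      linarith) ⌊x / 16⌋₊
  have hfl : x / 16 < (⌊x / 16⌋₊ : ℝ) + 1 := Nat.lt_floor_add_one _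
  have hfl' : (⌊x / 16⌋₊ : ℝ) ≤ x / 16 := Nat.floor_le (by linarith)
  have hexp : Real.exp (-(⌊x / 16⌋₊ * (γ / (N + γ)))) ≤ Real.exp (-(r * ℓ)) := by
    rw [Real.exp_le_exp, neg_le_neg_iff]
    calc r * ℓ ≤ x / 32 * (γ / (N + N)) := by
          have e : x / 32 * (γ / (N + N)) = ε * x * x / (4096 * (N * b)) := by
            rw [hγdef]; field_simp; norm_num
          rw [e, le_div_iff₀ (by positivity)]
          refine le_trans ?_ hx2
          have h1 : r * ℓ ≤ R * ℓ := mul_le_mul_of_nonneg_right (by linarith) (by linarith)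
          have := mul_le_mul_of_nonneg_left h1 (by positivity : 0 ≤ 4096 * (N * (b : ℝ)))
          linarith
      _ ≤ ⌊x / 16⌋₊ * (γ / (N + γ)) := by
        gcongr
        linarith
  -- With `R = r + 1`: `N * N ^ (-(r + 3 / 2)) * √N = N ^ (-r)`.
  have hβ : prob π bad * ((N + γ) / γ) ≤ Real.exp (-(r * ℓ)) := by
    have h1 : (N + γ) / γ ≤ g := by
      rw [div_le_iff₀ hγ]
      have h2 : 2 * N ≤ g * γ := by
        rw [hγdef, mul_div_assoc', le_div_iff₀ (by positivity), ← hgN]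
        have := mul_le_mul_of_nonneg_left hb2g (by linarith : 0 ≤ g)
        linarith
      linarith
    have h3 : Real.exp ℓ = N := by rw [hℓ, Real.exp_log hNR]
    have h4 : Real.exp (ℓ / 2) = g := by
      rw [hg, hℓ, Real.exp_half, Real.exp_log hNR]
    calc prob π bad * ((N + γ) / γ) ≤ (N * Real.exp (-((R + 1 / 2) * ℓ))) * g := by
          gcongr
      _ = Real.exp (-(r * ℓ)) := by
        rw [← h3, ← h4, ← Real.exp_add, ← Real.exp_add]
        congr 1
        rw [hRdef]; ring
  have hNr : Real.exp (-(r * ℓ)) = 1 / (N : ℝ) ^ r := by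
    rw [Real.exp_neg, Real.exp_nat_mul, hℓ, Real.exp_log hNR, one_div]
  refine (prob_mono hπ.1 ?_).trans (hlyap.trans (by
    have : 2 / (N : ℝ) ^ r = 1 / (N : ℝ) ^ r + 1 / (N : ℝ) ^ r := by ring
    rw [this, ← hNr]
    exact add_le_add hexp hβ))
  -- The Lyapunov value exceeds `7 * x / 32 - 1`, and `96 ≤ x` lifts this to `2 * (x / 32 + 1) + x /
  -- 8`.
  intro q hq
  have h1 := sub_le_rampSum (c := (t : ℕ) + 1 + x / 2) (w := x / 32) (by positivity) (by linarith)
    (busy univ q).toNat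
  have hB : (((busy univ q).toNat : ℕ) : ℝ) = busy univ q := by
    have := Int.toNat_of_nonneg (busy_nonneg univ q)
    exact_mod_cast this
  have h2 : (total q : ℝ) = busy univ q + waiting q := by rw [total_eq]; push_cast; rfl
  unfold lyapunov
  rw [hB] at h1
  linarith

theorem avgQueue_le (hN : 0 < N) (q : State N b) : avgQueue q ≤ b := by
  have hNR : (0 : ℝ) < N := by exact_mod_cast hN
  rw [avgQueue_eq, div_le_iff₀ hNR]
  exact_mod_cast total_le q

theorem expect_le_mul_prob (hπ : π ∈ stdSimplex ℝ (State N b)) {f : State N b → ℝ} {C : ℝ}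
    {p : State N b → Prop} (h1 : ∀ q, p q → f q ≤ C) (h2 : ∀ q, ¬ p q → f q ≤ 0) :
    expect π f ≤ C * prob π p := by
  classical
  unfold expect prob
  rw [mul_sum]
  refine sum_le_sum fun q _ => ?_
  by_cases h : p q
  · rw [if_pos h, mul_comm C]
    exact mul_le_mul_of_nonneg_left (h1 q h) (hπ.1 q)
  · rw [if_neg h, mul_zero]
    exact mul_nonpos_of_nonneg_of_nonpos (hπ.1 q) (h2 q h)

theorem load_mul (hN : 0 < N) (α : ℝ) : load N α * N = N - (N : ℝ) ^ (1 - α) := by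
  have hNR : (0 : ℝ) < N := by exact_mod_cast hN
  rw [load, sub_mul, one_mul, sub_eq_add_neg 1 α, add_comm 1, Real.rpow_add hNR, Real.rpow_one]

/-- The moment bound when the spare capacity `x` is large. -/
theorem expect_le_of_large_capacity (hN : 2 ≤ N) (hb : 2 ≤ b) (hμ : Antitone μ) {ε : ℝ}
    (hε : 0 < ε) (hμε : ∀ n, ε ≤ μ n) (hε2 : ε ≤ 1 / 2) (hsum : ∑ n, μ n = N) {r : ℕ} {x : ℝ}
    (hr : 0 < r) (hx0 : 0 < x) (hΛ : 0 ≤ (N : ℝ) - x) (hπ : IsSteadyState ((N : ℝ) - x) μ π)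
    (t : Fin N) (ht : ∑ n ∈ Iic t, μ n = N - x) (hεℓ : 2 * ((r : ℝ) + 1) ≤ ε * Real.log N)
    (hx : 729 * ((r : ℝ) + 1) ^ 2 * b ^ 2 * Real.log N ^ 2 * √N ≤ ε ^ 2 * x)
    (hμ₁ : 256 * Real.log N ^ 2 * μ ⟨0, by omega⟩ ≤ ε ^ 2 * x) :
    expect π (fun q => (max (avgQueue q - ((t : ℕ) + 1) / N
      - (1 - 4 / (kSub b ε (μ t) * ε)) * (x / N)) 0) ^ r) ≤ (kSub b ε (μ t) / x) ^ r := by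
  have hN0 : 0 < N := by omega
  have hNR : (0 : ℝ) < N := by exact_mod_cast hN0
  have hrR : (1 : ℝ) ≤ r := by exact_mod_cast hr
  have hbR : (2 : ℝ) ≤ b := by exact_mod_cast hb
  have hk : 16 * (b - 1) ≤ kSub b ε (μ t) * ε := by
    unfold kSub
    rw [div_mul_eq_mul_div, le_div_iff₀ (by positivity)]
    have h1 := mul_le_mul_of_nonneg_left (hμε t)
      (by nlinarith : 0 ≤ 16 * ((b : ℝ) - 1) * ε)
    linarith
  have hk0 : 0 < kSub b ε (μ t) := by
    have h1 : 0 < kSub b ε (μ t) * ε := by linarith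
    exact pos_of_mul_pos_left h1 hε.le
  have hk2 : 2 * b ≤ kSub b ε (μ t) := by nlinarith
  -- Hence the threshold in the expectation is at least `t + 1 + 3 * x / 4` jobs.
  have hδ : 4 / (kSub b ε (μ t) * ε) ≤ 1 / 4 := by
    rw [div_le_div_iff₀ (by positivity) (by norm_num)]
    linarith
  have hδ0 : 0 ≤ 4 / (kSub b ε (μ t) * ε) := by positivity
  set δ := 4 / (kSub b ε (μ t) * ε)
  have hp := prob_total_gt_le hN hb hμ hε hμε hε2 hsum hr hΛ hπ t ht rfl rfl hεℓ hx hμ₁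
  refine (expect_le_mul_prob hπ.1 (C := (b : ℝ) ^ r)
    (p := fun q => (t : ℕ) + 1 + 3 / 4 * x < total q) ?_ ?_).trans ?_
  · intro q _
    refine pow_le_pow_left₀ (le_max_right _ _) (max_le ?_ (by positivity)) r
    have h1 := avgQueue_le hN0 q
    have h2 : 0 ≤ (((t : ℕ) : ℝ) + 1) / N := by positivity
    have h3 : 0 ≤ (1 - δ) * (x / N) := mul_nonneg (by linarith) (by positivity)
    linarith
  · intro q hq
    rw [max_eq_right, zero_pow hr.ne']
    have h1 : 3 / 4 * (x / N) ≤ (1 - δ) * (x / N) :=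
      mul_le_mul_of_nonneg_right (by linarith) (by positivity)
    have h2 : avgQueue q ≤ (((t : ℕ) : ℝ) + 1 + 3 / 4 * x) / N := by
      rw [avgQueue_eq]
      exact div_le_div_of_nonneg_right (not_lt.1 hq) hNR.le
    have h3 : (((t : ℕ) : ℝ) + 1 + 3 / 4 * x) / N = (((t : ℕ) : ℝ) + 1) / N + 3 / 4 * (x / N) := by
      ring
    linarith
  · calc (b : ℝ) ^ r * prob π (fun q => (t : ℕ) + 1 + 3 / 4 * x < total q)
        ≤ (b : ℝ) ^ r * (2 ^ r / (N : ℝ) ^ r) := by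
          refine mul_le_mul_of_nonneg_left (hp.trans ?_) (by positivity)
          gcongr
          exact le_self_pow₀ one_le_two hr.ne'
      _ = (2 * b / N) ^ r := by rw [div_pow, mul_pow]; ring
      _ ≤ (kSub b ε (μ t) / x) ^ r := by
          gcongr
          linarith

end JFSQ

/-! ### Translation to the stated parameters -/

theorem theorem2 (N b r : ℕ) (hN : 2 ≤ N) (hb : 2 ≤ b) (hr : 0 < r) (α ε : ℝ) (hε : 0 < ε)
    (μ : Fin N → ℝ) (hμ_anti : Antitone μ) (hμ_lower : ∀ n, ε ≤ μ n) (hμ_sum : ∑ n, μ n = N)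
    (π : JFSQ.State N b → ℝ) (hπ : JFSQ.IsSteadyState (JFSQ.load N α * N) μ π) :
    -- Sub-Halfin-Whitt regime
    (0 < α → α < 1 / 2 → JFSQ.SubCondition N b r α ε (μ ⟨0, by omega⟩) →
      ∀ (N₂ : ℕ) (_ : 1 ≤ N₂) (_ : N₂ ≤ N),
        JFSQ.load N α * N = ∑ n ∈ univ.filter (fun n : Fin N => (n : ℕ) < N₂), μ n →
        JFSQ.expect π (fun q =>
            (max (JFSQ.avgQueue q - (N₂ : ℝ) / N
              - (1 - 4 / (JFSQ.kSub b ε (μ ⟨N₂ - 1, by omega⟩) * ε)) * (1 / (N : ℝ) ^ α)) 0) ^ r)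
          ≤ (JFSQ.kSub b ε (μ ⟨N₂ - 1, by omega⟩) / (N : ℝ) ^ (1 - α)) ^ r) ∧
    -- Super-Halfin-Whitt regime
    (1 / 2 ≤ α → α < 1 → JFSQ.SuperCondition N b r α ε (μ ⟨0, by omega⟩) →
      JFSQ.expect π (fun q =>
          (max (JFSQ.avgQueue q - 1
            - JFSQ.kSuper b r ε (μ ⟨0, by omega⟩) * Real.log N / (N : ℝ) ^ (1 - α)) 0) ^ r)
        ≤ 10 * (2 * (r : ℝ) / (N : ℝ) ^ (1 - α)) ^ r) := by
  have hN0 : 0 < N := by omega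
  have hNR : (0 : ℝ) < N := by exact_mod_cast hN0
  have hN1 : (1 : ℝ) < N := by exact_mod_cast hN
  have hrR : (1 : ℝ) ≤ r := by exact_mod_cast hr
  have hbR : (2 : ℝ) ≤ b := by exact_mod_cast hb
  have hℓ : 0 < Real.log N := Real.log_pos hN1
  have hx0 : 0 < (N : ℝ) ^ (1 - α) := by positivity
  rw [JFSQ.load_mul hN0] at *
  refine ⟨?_, ?_⟩
  · rintro hα hα' ⟨hmax, hε2, hμ₁⟩ N₂ hN₂ hN₂N hcap
    have h1 := (le_max_left _ _).trans hmax
    have h2 := (le_max_right _ _).trans hmax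
    rw [div_le_iff₀ hℓ] at h1
    rw [div_le_iff₀ (by positivity)] at h2
    have hε2' : ε ≤ 1 / 2 := by norm_num at hε2 ⊢; exact hε2
    rw [div_le_div_iff₀ (by positivity) (by positivity)] at hμ₁
    have hxN : (N : ℝ) ^ (1 - α) ≤ N := by
      conv_rhs => rw [← Real.rpow_one (N : ℝ)]
      exact Real.rpow_le_rpow_of_exponent_le hN1.le (by linarith)
    have hsq : √(N : ℝ) * ((N : ℝ) ^ (0.25 - 0.5 * α)) ^ 2 = (N : ℝ) ^ (1 - α) := by
      rw [Real.sqrt_eq_rpow, ← Real.rpow_natCast, ← Real.rpow_mul hNR.le, ← Real.rpow_add hNR]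
      congr 1
      norm_num
      ring
    have hfilter : univ.filter (fun n : Fin N => (n : ℕ) < N₂) = Iic ⟨N₂ - 1, by omega⟩ := by
      ext n
      simp only [mem_filter, mem_univ, true_and, mem_Iic, Fin.le_def]
      omega
    rw [hfilter] at hcap
    have hmain := JFSQ.expect_le_of_large_capacity hN hb hμ_anti hε hμ_lower hε2' hμ_sum hr hx0
      (by linarith) hπ ⟨N₂ - 1, by omega⟩ hcap.symm h1 ?_ ?_
    · have e1 : ((N₂ - 1 : ℕ) : ℝ) + 1 = N₂ := by
        rw [Nat.cast_sub hN₂]; push_cast; ring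
      have e2 : (N : ℝ) ^ (1 - α) / N = 1 / (N : ℝ) ^ α := by
        rw [Real.rpow_sub hNR, Real.rpow_one]
        field_simp
      simp only [e1, e2] at hmain
      exact hmain
    -- Squaring the lower bound on `ε` gives `27 ^ 2 = 729`.
    · rw [← hsq]
      have h3 := pow_le_pow_left₀ (by positivity) h2 2
      have h4 := mul_le_mul_of_nonneg_right h3 (Real.sqrt_nonneg (N : ℝ))
      linarith
    · have h3 : 0 ≤ μ ⟨0, by omega⟩ := hε.le.trans (hμ_lower _)
      have h4 : 128 * (2 * Real.log N ^ 2) ≤ 64 * b * (2 * Real.log N ^ 2 + 3) :=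
        mul_le_mul (by linarith) (by linarith) (by positivity) (by positivity)
      have h5 := mul_le_mul_of_nonneg_left h4 h3
      linarith
  · intro hα hα' hcond
    -- This is where `1 / 2 ≤ α` enters.
    have hxN : ((N : ℝ) ^ (1 - α)) ^ 2 ≤ N := by
      rw [← Real.rpow_natCast, ← Real.rpow_mul hNR.le]
      conv_rhs => rw [← Real.rpow_one (N : ℝ)]
      exact Real.rpow_le_rpow_of_exponent_le hN1.le (by push_cast; linarith)
    exact JFSQ.expect_le_of_sq_le hN hb hr hε hμ_lower
      (fun n => hμ_anti (by rw [Fin.le_def]; exact Nat.zero_le _)) hμ_sum hx0 hxN hπ hcond
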